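/- **Theorem.** Conventions. A language is a set of relation symbols, each of positive finite arity; a structure is a finite (possibly empty) or countably infinite set of vertices with an interpretation of the symbols; substructures are induced. The *Gaifman graph* of a structure $A$ joins two distinct vertices when some tuple of some relation contains both; $A$ is *connected* if this graph is connected (so $A\neq\emptyset$), and *irreducible* if any two distinct vertices are joined. A homomorphism is a *homomorphism-embedding* if its restriction to every irreducible substructure is an embedding. For a family $\mathcal F$ of finite $L$-structures, $\mathrm{Forb}(\mathcal F)$ is the class of finite or countable $L$-structures $A$ such that no $F\in\mathcal F$ has a homomorphism-embedding into $A$. A family $\mathcal F$ of finite connected structures is *upwards closed* if $F'\in\mathcal F$ whenever $F'$ is a finite connected structure and some $F\in\mathcal F$ has a homomorphism-embedding $F\to F'$. A structure $U$ is *universal* for a class if every member of the class embeds into $U$. $U$ is *$\omega$-categorical* if its automorphism group has finitely many orbits on $n$-tuples for every $n$, and *ultrahomogeneous* if every isomorphism between finite substructures of $U$ extends to an automorphism. Pieces. Let $A$ be connected. For a set $R$ of vertices, the components of $A$ with cut $R$ are the connected components of the Gaifman graph after removal of $R$. If $A_1\ne A_2$ are two such components whose neighbourhoods in the Gaifman graph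 are both equal to $R$, then the structure induced by $A$ on $A_1\cup R$, rooted at an enumeration $\vec R$ of $R$, is a *piece* of $A$ of *width* $|R|$. For structures $P,Q$ rooted at tuples $\vec R,\vec S$ of distinct vertices, of the same length, which induce isomorphic rooted structures on the roots, $P\oplus Q$ is the free amalgamation of $P$ and $Q$ with corresponding roots identified. Two pieces $P,P'$ of the same width of members of $\mathcal F$ are *equivalent* if for every rooted structure $Q$: $P\oplus Q$ is defined and isomorphic to a member of $\mathcal F$ if and only if $P'\oplus Q$ is. $\mathcal F$ is *regular* if for every $n\ge 1$ there are only finitely many equivalence classes of pieces of width $n$ of members of $\mathcal F$. Let $L$ be a finite language and $\mathcal F$ an upwards closed family of finite connected $L$-structures. The following are equivalent: (a) $\mathcal F$ is regular. (b) There are a language $L^+\supseteq L$ such that $L^+\setminus L$ has only finitely many symbols of each arity, and an ultrahomogeneous $L^+$-structure $U^+$ in which the relations in $L^+\setminus L$ contain only tuples of pairwise distinct vertices, such that the $L$-reduct (shadow) of $U^+$ belongs to $\mathrm{Forb}(\mathcal F)$ and is universal for $\mathrm{Forb}(\mathcal F)$. (c) $\mathrm{Forb}(\mathcal F)$ contains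 an $\omega$-categorical structure that is universal for $\mathrm{Forb}(\mathcal F)$. -/

import Mathlib

/-
Relational structures are Mathlib's first-order structures over a language without function
symbols.  All structures live in `Type` (every countable structure has an isomorphic copy there).
-/

universe u v

namespace ForbLift

open FirstOrder CategoryTheory

variable {L : FirstOrder.Language.{u, v}}

/-- The Gaifman graph of a structure: two distinct vertices are adjacent iff some tuple of some
relation contains both. -/
def gaifman (L : FirstOrder.Language.{u, v}) (A : Type) [L.Structure A] : SimpleGraph A where
  Adj x y := x ≠ y ∧ ∃ (n : ℕ) (r : L.Relations n) (t : Fin n → A),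
    FirstOrder.Language.Structure.RelMap r t ∧ x ∈ Set.range t ∧ y ∈ Set.range t
  symm := ⟨fun _ _ ⟨hne, n, r, t, ht, hx, hy⟩ => ⟨hne.symm, n, r, t, ht, hy, hx⟩⟩
  loopless := ⟨fun _ h => h.1 rfl⟩

/-- A structure is connected if its Gaifman graph is (in particular it is nonempty). -/
def IsConn (L : FirstOrder.Language.{u, v}) (A : Type) [L.Structure A] : Prop :=
  (gaifman L A).Connected

/-- A structure is irreducible if any two distinct vertices lie in a common tuple of some
relation. -/
def IsIrred (L : FirstOrder.Language.{u, v}) (A : Type) [L.Structure A] : Prop :=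
  ∀ x y : A, x ≠ y → ∃ (n : ℕ) (r : L.Relations n) (t : Fin n → A),
    FirstOrder.Language.Structure.RelMap r t ∧ x ∈ Set.range t ∧ y ∈ Set.range t

/-- A homomorphism is a homomorphism-embedding if its restriction to every irreducible (induced)
substructure is an embedding. -/
def IsHomEmb {A B : Type} [L.Structure A] [L.Structure B] (f : A →[L] B) : Prop :=
  ∀ S : L.Substructure A, IsIrred L S → ∃ g : S ↪[L] B, ∀ x : S, g x = f x

/-- `Forb(F)`: the finite or countable structures admitting no homomorphism-embedding from a
member of `F`. -/
def Forb (F : Set (Bundled.{0} L.Structure)) : Set (Bundled.{0} L.Structure) :=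
  {A | Countable A ∧ ∀ G ∈ F, ∀ f : G →[L] A, ¬ IsHomEmb f}

/-- A family `F` of finite structures is upwards closed if it contains every finite connected
structure that receives a homomorphism-embedding from a member of `F`. -/
def UpwardsClosed (F : Set (Bundled.{0} L.Structure)) : Prop :=
  ∀ G ∈ F, ∀ H : Bundled.{0} L.Structure, Finite H → IsConn L H →
    (∃ f : G →[L] H, IsHomEmb f) → H ∈ F

/-- `U` is (embedding-)universal for the class `K`. -/
def IsUniversalFor (U : Bundled.{0} L.Structure) (K : Set (Bundled.{0} L.Structure)) : Prop :=
  ∀ A ∈ K, Nonempty (A ↪[L] U)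

/-- Two `n`-tuples are in the same orbit of the automorphism group. -/
def orbitSetoid (L : FirstOrder.Language.{u, v}) (U : Type) [L.Structure U] (n : ℕ) :
    Setoid (Fin n → U) where
  r x y := ∃ g : U ≃[L] U, ∀ i, g (x i) = y i
  iseqv :=
    { refl := fun _ => ⟨FirstOrder.Language.Equiv.refl L U, fun _ => rfl⟩
      symm := fun ⟨g, hg⟩ => ⟨g.symm, fun i => by rw [← hg i]; exact g.symm_apply_apply _⟩
      trans := fun ⟨g, hg⟩ ⟨h, hh⟩ => ⟨h.comp g, fun i => by
        rw [FirstOrder.Language.Equiv.comp_apply, hg i, hh i]⟩ }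

/-- A structure is ω-categorical if its automorphism group has only finitely many orbits on
`n`-tuples, for every `n`. -/
def IsOmegaCategorical (L : FirstOrder.Language.{u, v}) (U : Type) [L.Structure U] : Prop :=
  ∀ n : ℕ, Finite (Quotient (orbitSetoid L U n))

/-- A structure rooted at an `n`-tuple of distinct vertices. -/
structure Rooted (L : FirstOrder.Language.{u, v}) (n : ℕ) where
  carrier : Type
  [str : L.Structure carrier]
  root : Fin n ↪ carrier

attribute [instance] Rooted.str

/-- `C` is (the vertex set of) a component of `A` with cut `R`, that is, a connected component of
the Gaifman graph of `A` after the removal of `R`. -/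
def IsComponent (L : FirstOrder.Language.{u, v}) {A : Type} [L.Structure A] (R C : Set A) : Prop :=
  ∃ c : ((gaifman L A).induce Rᶜ).ConnectedComponent, C = Subtype.val '' c.supp

/-- The neighbourhood of a set of vertices in the Gaifman graph. -/
def nbhd (L : FirstOrder.Language.{u, v}) {A : Type} [L.Structure A] (S : Set A) : Set A :=
  {x | x ∉ S ∧ ∃ y ∈ S, (gaifman L A).Adj x y}

/-- `R` is a minimal separating cut for the two different components `C₁`, `C₂` of `A` with
cut `R`. -/
def IsMinSepCut (L : FirstOrder.Language.{u, v}) {A : Type} [L.Structure A] (R C₁ C₂ : Set A) : Prop :=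
  IsComponent L R C₁ ∧ IsComponent L R C₂ ∧ C₁ ≠ C₂ ∧ nbhd L C₁ = R ∧ nbhd L C₂ = R

/-- `P` is (isomorphic to) a piece of `A`: the structure induced by `A` on `C₁ ∪ R`, rooted at an
enumeration of `R`, where `R` is a minimal separating cut for the component `C₁` in `A`. -/
def IsPiece {n : ℕ} (P : Rooted L n) (A : Type) [L.Structure A] : Prop :=
  ∃ (R C₁ C₂ : Set A) (e : P.carrier ↪[L] A), IsMinSepCut L R C₁ C₂ ∧
    Set.range e = C₁ ∪ R ∧ Set.range (fun i => e (P.root i)) = R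

/-- `G` is, via the embeddings `f` and `g`, the free amalgamation of `P` and `Q` with corresponding
roots identified.  Such a `G` exists iff `P` and `Q` induce isomorphic rooted structures on their
roots, and then it is unique up to isomorphism. -/
structure IsFreeAmalgam {n : ℕ} (P Q : Rooted L n) {G : Type} [L.Structure G]
    (f : P.carrier ↪[L] G) (g : Q.carrier ↪[L] G) : Prop where
  root_eq : ∀ i, f (P.root i) = g (Q.root i)
  cover : Set.range f ∪ Set.range g = Set.univ
  strong : ∀ x y, f x = g y → x ∈ Set.range P.root ∧ y ∈ Set.range Q.root
  free : ∀ (k : ℕ) (r : L.Relations k) (t : Fin k → G), FirstOrder.Language.Structure.RelMap r t →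
    (∀ i, t i ∈ Set.range f) ∨ (∀ i, t i ∈ Set.range g)

/-- The rooted structures incompatible with `P`: those `Q` for which `P ⊕ Q` is defined and
isomorphic to a member of `F`. -/
def incompatible (F : Set (Bundled.{0} L.Structure)) {n : ℕ} (P : Rooted L n) :
    Set (Rooted L n) :=
  {Q | ∃ G ∈ F, ∃ (f : P.carrier ↪[L] G) (g : Q.carrier ↪[L] G), IsFreeAmalgam P Q f g}

/-- The pieces of width `n` of members of `F`. -/
def Piece (F : Set (Bundled.{0} L.Structure)) (n : ℕ) : Type (max 1 u v) :=
  {P : Rooted L n // ∃ G ∈ F, IsPiece P G}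

/-- The piece equivalence: two pieces are equivalent if they have the same incompatible rooted
structures. -/
def pieceEquiv (F : Set (Bundled.{0} L.Structure)) (n : ℕ) : Setoid (Piece F n) where
  r P Q := incompatible F P.1 = incompatible F Q.1
  iseqv := ⟨fun _ => rfl, fun h => h.symm, fun h k => h.trans k⟩

/-- `F` is regular if the piece equivalence has only finitely many classes of each width
`n ≥ 1`. -/
def IsRegular (F : Set (Bundled.{0} L.Structure)) : Prop :=
  ∀ n : ℕ, 1 ≤ n → Finite (Quotient (pieceEquiv F n))

/-- The shadow of a structure in the extended language `L.sum L'`: its reduct to `L`. -/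
def shadow {L' : FirstOrder.Language.{0, 0}} (U : Bundled.{0} (L.sum L').Structure) :
    Bundled.{0} L.Structure :=
  ⟨U, (FirstOrder.Language.LHom.sumInl : L →ᴸ L.sum L').reduct U⟩

end ForbLift

/-! The proof is a Myhill–Nerode argument for free amalgamation. Call a structure bad if some member
of `F` has a homomorphism-embedding into it. Two rooted structures are `Nerode`-equivalent if they
agree on their roots and become bad when amalgamated freely with exactly the same rooted structures.
This relation concerns all rooted structures, not only pieces, and by `Nerode.glue` it is a
congruence for free amalgamation.

(a) → (b). `IsRegular.finite_nerode` derives finite index of `Nerode` from regularity, by induction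
on the width. If a bad amalgam of `B` with something contains a member `W` of `F`, let `X` be a
component of `W` minus the roots that lies in `B`. Either `X` sees only some of the roots (smaller
width), or `X` with the roots is a piece of `W`, or `X` is the only component seeing all roots; in
the last case the rest of `W` is glued from parts of smaller width (`finite_compsIn`). Hence
finitely many data determine the class of `B`. Now colour every injective tuple of a structure by
its class. Amalgamating freely over equivalent tuples creates nothing bad and alters no colour
(`Nerode.amalgam_left`), so a countable structure realizing all one-point extensions exists
(`exists_generic`). With a predicate for each colour, this extension property yields both
ultrahomogeneity and universality.

(b) → (c). New relations hold only on injective tuples, so only finitely many symbols matter for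
`n`-tuples, and ultrahomogeneity turns quantifier-free types into orbits.

(c) → (a). The orbits of `U` that a piece can reach with its roots, together with the relations on
the roots, determine the class of the piece; there are finitely many possibilities
(`isRegular_of_universal`). -/

namespace ForbLift

open FirstOrder CategoryTheory FirstOrder.Language FirstOrder.Language.Structure

/-! ### Homomorphism-embeddings, connectedness and bad structures -/

section Basics

variable {L : FirstOrder.Language.{u, v}}
variable {A B C D : Type} [L.Structure A] [L.Structure B] [L.Structure C] [L.Structure D]

/-- A set of vertices inducing an irreducible substructure. -/
def IrrOn (L : FirstOrder.Language.{u, v}) {A : Type} [L.Structure A] (I : Set A) : Prop :=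
  ∀ x ∈ I, ∀ y ∈ I, x ≠ y → ∃ (n : ℕ) (r : L.Relations n) (t : Fin n → A),
    RelMap r t ∧ (∀ i, t i ∈ I) ∧ x ∈ Set.range t ∧ y ∈ Set.range t

/-- A map whose restriction to the structure induced on `W` is a homomorphism-embedding. -/
structure HomEmbOn (L : FirstOrder.Language.{u, v}) {A B : Type} [L.Structure A] [L.Structure B]
    (h : A → B) (W : Set A) : Prop where
  hom : ∀ {n : ℕ} (r : L.Relations n) (t : Fin n → A), (∀ i, t i ∈ W) → RelMap r t →
    RelMap r (h ∘ t)
  inj : ∀ I ⊆ W, IrrOn L I → Set.InjOn h I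
  reflect : ∀ I ⊆ W, IrrOn L I → ∀ {n : ℕ} (r : L.Relations n) (t : Fin n → A), (∀ i, t i ∈ I) →
    RelMap r (h ∘ t) → RelMap r t

/-- A homomorphism-embedding, as a plain map. -/
abbrev HomEmb (L : FirstOrder.Language.{u, v}) {A B : Type} [L.Structure A] [L.Structure B]
    (h : A → B) : Prop := HomEmbOn L h Set.univ

theorem HomEmbOn.irrOn_image {h : A → B} {W I : Set A} (hh : HomEmbOn L h W) (hI : I ⊆ W)
    (hirr : IrrOn L I) : IrrOn L (h '' I) := by
  rintro _ ⟨x, hx, rfl⟩ _ ⟨y, hy, rfl⟩ hne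
  obtain ⟨n, r, t, ht, htI, ⟨i, rfl⟩, ⟨j, rfl⟩⟩ := hirr x hx y hy (fun e => hne (e ▸ rfl))
  exact ⟨n, r, h ∘ t, hh.hom r t (fun i => hI (htI i)) ht, fun i => ⟨_, htI i, rfl⟩,
    ⟨i, rfl⟩, ⟨j, rfl⟩⟩

theorem HomEmbOn.comp {k : B → C} {h : A → B} {V : Set B} {W : Set A} (hk : HomEmbOn L k V)
    (hh : HomEmbOn L h W) (hm : Set.MapsTo h W V) : HomEmbOn L (k ∘ h) W where
  hom r t ht hr := hk.hom r (h ∘ t) (fun i => hm (ht i)) (hh.hom r t ht hr)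
  inj I hI hirr := (hk.inj (h '' I) (Set.image_subset_iff.2 fun _ hx => hm (hI hx))
    (hh.irrOn_image hI hirr)).comp (hh.inj I hI hirr) (Set.mapsTo_image h I)
  reflect I hI hirr _ r t ht hr := hh.reflect I hI hirr r t ht
    (hk.reflect (h '' I) (Set.image_subset_iff.2 fun _ hx => hm (hI hx))
      (hh.irrOn_image hI hirr) r (h ∘ t) (fun i => ⟨_, ht i, rfl⟩) hr)

theorem HomEmb.comp {k : B → C} {h : A → B} (hk : HomEmb L k) (hh : HomEmb L h) :
    HomEmb L (k ∘ h) :=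
  HomEmbOn.comp hk hh (Set.mapsTo_univ _ _)

theorem homEmb_embedding (f : A ↪[L] B) : HomEmb L f where
  hom r t _ hr := (f.map_rel r t).2 hr
  inj _ _ _ := f.injective.injOn
  reflect _ _ _ _ r t _ hr := (f.map_rel r t).1 hr

/-- In `IrrOn` the witnessing tuples lie inside the set itself, so irreducible subsets of the range
of an embedding pull back to irreducible sets. -/
theorem HomEmbOn.of_comp_embedding (e : A ↪[L] B) {h : B → C} (hh : HomEmb L (h ∘ e)) :
    HomEmbOn L h (Set.range e) := by
  have key : ∀ I ⊆ Set.range e, IrrOn L I → IrrOn L (e ⁻¹' I) := by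
    intro I hI hirr x hx y hy hne
    obtain ⟨n, r, t, ht, htI, ⟨i, hi⟩, ⟨j, hj⟩⟩ := hirr _ hx _ hy (e.injective.ne hne)
    choose s hs using fun k => hI (htI k)
    obtain rfl : e ∘ s = t := funext hs
    exact ⟨n, r, s, (e.map_rel r s).1 ht, htI, ⟨i, e.injective hi⟩, ⟨j, e.injective hj⟩⟩
  refine ⟨fun r t ht hr => ?_, fun I hI hirr => ?_, fun I hI hirr n r t ht hr => ?_⟩
  · choose s hs using ht
    obtain rfl : e ∘ s = t := funext hs
    exact hh.hom r s (fun _ => trivial) ((e.map_rel r s).1 hr)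
  · intro x hx y hy hxy
    obtain ⟨x, rfl⟩ := hI hx
    obtain ⟨y, rfl⟩ := hI hy
    exact congrArg e (hh.inj _ (Set.subset_univ _) (key I hI hirr) hx hy hxy)
  · choose s hs using fun k => hI (ht k)
    obtain rfl : e ∘ s = t := funext hs
    exact (e.map_rel r s).2
      (hh.reflect _ (Set.subset_univ _) (key I hI hirr) r s ht hr)

/-- A map that is a homomorphism-embedding on both parts of a free cover is one globally. -/
theorem HomEmbOn.glue {h : A → B} {V W : Set A} (hV : HomEmbOn L h V) (hW : HomEmbOn L h W)
    (hfree : ∀ (n : ℕ) (r : L.Relations n) (t : Fin n → A), RelMap r t →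
      (∀ i, t i ∈ V) ∨ (∀ i, t i ∈ W)) (hcov : V ∪ W = Set.univ) : HomEmb L h := by
  -- No irreducible set straddles a free cover: a tuple joining a vertex outside `V` to one outside
  -- `W` would lie in neither part.
  have key : ∀ I : Set A, IrrOn L I → I ⊆ V ∨ I ⊆ W := by
    intro I hirr
    by_contra! hcon
    obtain ⟨⟨x, hx, hxV⟩, ⟨y, hy, hyW⟩⟩ := Set.not_subset.1 hcon.1, Set.not_subset.1 hcon.2
    have hxW : x ∈ W := ((Set.ext_iff.1 hcov x).2 trivial).resolve_left hxV
    obtain ⟨n, r, t, ht, -, ⟨i, rfl⟩, ⟨j, rfl⟩⟩ := hirr x hx y hy fun e => hyW (e ▸ hxW)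
    rcases hfree n r t ht with h' | h'
    · exact hxV (h' i)
    · exact hyW (h' j)
  refine ⟨fun r t _ hr => ?_, fun I _ hirr => ?_, fun I _ hirr n r t ht hr => ?_⟩
  · exact (hfree _ r t hr).elim (fun h' => hV.hom r t h' hr) fun h' => hW.hom r t h' hr
  · exact (key I hirr).elim (fun h' => hV.inj I h' hirr) fun h' => hW.inj I h' hirr
  · exact (key I hirr).elim (fun h' => hV.reflect I h' hirr r t ht hr)
      fun h' => hW.reflect I h' hirr r t ht hr

variable [L.IsRelational]

/-- A homomorphism of relational structures from a relation-preserving map. -/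
def mkHom (f : A → B) (h : ∀ {n : ℕ} (r : L.Relations n) (t : Fin n → A), RelMap r t →
    RelMap r (f ∘ t)) : A →[L] B where
  toFun := f
  map_fun' f := isEmptyElim f
  map_rel' r t := h r t

/-- An embedding of relational structures. -/
def mkEmb (f : A → B) (hf : Function.Injective f)
    (h : ∀ {n : ℕ} (r : L.Relations n) (t : Fin n → A), RelMap r (f ∘ t) ↔ RelMap r t) :
    A ↪[L] B where
  toFun := f
  inj' := hf
  map_fun' f := isEmptyElim f
  map_rel' r t := h r t

@[simp] theorem mkEmb_apply (f : A → B) (hf : Function.Injective f)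
    (h : ∀ {n : ℕ} (r : L.Relations n) (t : Fin n → A), RelMap r (f ∘ t) ↔ RelMap r t) (x : A) :
    mkEmb f hf h x = f x := rfl

variable (L) in
/-- The substructure induced on a set of vertices. -/
def ind (W : Set A) : L.Substructure A := ⟨W, fun f => isEmptyElim f⟩

variable (L) in
/-- The inclusion of an induced substructure. -/
def indEmb (W : Set A) : ind L W ↪[L] A := (ind L W).subtype

theorem range_indEmb (W : Set A) : Set.range (indEmb L W) = W := Subtype.range_coe

/-- The corestriction of an embedding to an induced substructure. -/
def codEmb (f : A ↪[L] B) (W : Set B) (hf : ∀ x, f x ∈ W) : A ↪[L] ind L W :=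
  mkEmb (fun x => ⟨f x, hf x⟩) (fun _ _ e => f.injective (congrArg Subtype.val e))
    fun r t => f.map_rel r t

theorem exists_embedding_factor (e : A ↪[L] C) (f : B ↪[L] C) (h : ∀ x, ∃ y, f y = e x) :
    ∃ k : A ↪[L] B, ∀ x, f (k x) = e x := by
  choose k hk using h
  refine ⟨mkEmb k (fun x y hxy => e.injective (by rw [← hk, ← hk, hxy])) fun r t => ?_, hk⟩
  rw [← f.map_rel, ← e.map_rel]
  exact iff_of_eq (congrArg _ (funext fun i => hk (t i)))

theorem HomEmb.codRestrict {h : A → B} (hh : HomEmb L h) (W : Set B) (hW : ∀ x, h x ∈ W) :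
    HomEmb L (B := ind L W) (fun x => (⟨h x, hW x⟩ : ind L W)) where
  hom r t ht hr := hh.hom r t ht hr
  inj I hI hirr _ hx _ hy e := hh.inj I hI hirr hx hy (congrArg Subtype.val e)
  reflect I hI hirr _ r t ht hr := hh.reflect I hI hirr r t ht hr

theorem isHomEmb_iff (f : A →[L] B) : IsHomEmb f ↔ HomEmb L f := by
  constructor
  · intro hf
    have key : ∀ I : Set A, IrrOn L I → IsIrred L (ind L I) := by
      intro I hirr x y hne
      obtain ⟨n, r, t, ht, htI, ⟨i, hi⟩, ⟨j, hj⟩⟩ := hirr x.1 x.2 y.1 y.2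
        fun e => hne (Subtype.ext e)
      exact ⟨n, r, fun k => ⟨t k, htI k⟩, ht, ⟨i, Subtype.ext hi⟩, ⟨j, Subtype.ext hj⟩⟩
    refine ⟨fun r t _ hr => f.map_rel r t hr, fun I _ hirr => ?_, fun I _ hirr n r t ht hr => ?_⟩
    · obtain ⟨g, hg⟩ := hf _ (key I hirr)
      intro x hx y hy e
      have : g ⟨x, hx⟩ = g ⟨y, hy⟩ := by rw [hg, hg]; exact e
      exact congrArg Subtype.val (g.injective this)
    · obtain ⟨g, hg⟩ := hf _ (key I hirr)
      have : RelMap r (g ∘ fun k => (⟨t k, ht k⟩ : ind L I)) := by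
        convert hr using 1
        funext k
        exact hg _
      exact (g.map_rel r _).1 this
  · intro hf S hS
    have hirr : IrrOn L (S : Set A) := by
      intro x hx y hy hne
      obtain ⟨n, r, t, ht, ⟨i, hi⟩, ⟨j, hj⟩⟩ := hS ⟨x, hx⟩ ⟨y, hy⟩
        fun e => hne (congrArg Subtype.val e)
      exact ⟨n, r, fun k => (t k).1, ht, fun k => (t k).2, ⟨i, congrArg Subtype.val hi⟩,
        ⟨j, congrArg Subtype.val hj⟩⟩
    exact ⟨mkEmb (fun x => f x.1)
      (fun x y e => Subtype.ext (hf.inj S (Set.subset_univ _) hirr x.2 y.2 e))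
      fun r t => ⟨fun h => hf.reflect S (Set.subset_univ _) hirr r (fun k => (t k).1)
        (fun k => (t k).2) h, fun h => f.map_rel r (fun k => (t k).1) h⟩, fun _ => rfl⟩

omit [L.IsRelational]

/-- Connectedness in terms of sets closed under sharing a tuple; the later arguments use this form
and avoid walks. -/
theorem isConn_iff : IsConn L A ↔ Nonempty A ∧ ∀ K : Set A, K.Nonempty →
    (∀ (n : ℕ) (r : L.Relations n) (t : Fin n → A), RelMap r t → ∀ i j, t i ∈ K → t j ∈ K) →
    K = Set.univ := by
  rw [IsConn, SimpleGraph.connected_iff]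
  constructor
  · rintro ⟨hp, hne⟩
    refine ⟨hne, fun K ⟨x, hx⟩ hK => Set.eq_univ_of_forall fun y => ?_⟩
    have := (SimpleGraph.reachable_iff_reflTransGen _ _).1 (hp x y)
    induction this with
    | refl => exact hx
    | tail _ h ih =>
      obtain ⟨-, n, r, t, ht, ⟨i, rfl⟩, ⟨j, rfl⟩⟩ := h
      exact hK n r t ht i j ih
  · rintro ⟨hne, h⟩
    refine ⟨fun x y => ?_, hne⟩
    have := h {z | (gaifman L A).Reachable x z} ⟨x, SimpleGraph.Reachable.refl _⟩ (by
      intro n r t ht i j hi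
      by_cases e : t i = t j
      · rwa [← e]
      · exact SimpleGraph.Reachable.trans hi
          (SimpleGraph.Adj.reachable ⟨e, n, r, t, ht, ⟨i, rfl⟩, ⟨j, rfl⟩⟩))
    exact (Set.ext_iff.1 this y).2 trivial

theorem IsConn.of_surjective {h : A → B} (hh : HomEmb L h) (hs : Function.Surjective h)
    (hA : IsConn L A) : IsConn L B := by
  rw [isConn_iff] at hA ⊢
  refine ⟨hA.1.map h, fun K ⟨y, hy⟩ hK => ?_⟩
  obtain ⟨x, rfl⟩ := hs y
  have := hA.2 (h ⁻¹' K) ⟨x, hy⟩ fun n r t ht i j =>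
    hK n r (h ∘ t) (hh.hom r t (fun _ => trivial) ht) i j
  refine Set.eq_univ_of_forall fun z => ?_
  obtain ⟨z, rfl⟩ := hs z
  exact (Set.ext_iff.1 this z).2 trivial

/-- Some member of `F` has a homomorphism-embedding into `A`. -/
def Bad (F : Set (Bundled.{0} L.Structure)) (A : Type) [L.Structure A] : Prop :=
  ∃ G ∈ F, ∃ h : G → A, HomEmb L h

variable {F : Set (Bundled.{0} L.Structure)}

theorem Bad.map {h : A → B} (hh : HomEmb L h) : Bad F A → Bad F B :=
  fun ⟨G, hG, k, hk⟩ => ⟨G, hG, h ∘ k, hh.comp hk⟩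

theorem mem_forb_iff [L.IsRelational] (A : Bundled.{0} L.Structure) :
    A ∈ Forb F ↔ Countable A ∧ ¬ Bad F A := by
  refine and_congr_right fun _ => ⟨?_, ?_⟩
  · rintro h ⟨G, hG, k, hk⟩
    exact h G hG (mkHom k fun r t => hk.hom r t fun _ => trivial) ((isHomEmb_iff _).2 hk)
  · exact fun h G hG f hf => h ⟨G, hG, f, (isHomEmb_iff f).1 hf⟩

/-- The standing assumptions on the family of forbidden structures. -/
structure IsAdmissible (F : Set (Bundled.{0} L.Structure)) : Prop where
  finite : ∀ G ∈ F, Finite G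
  conn : ∀ G ∈ F, IsConn L G
  up : UpwardsClosed F

theorem IsAdmissible.mem_of_homEmb [L.IsRelational] (hF : IsAdmissible F)
    {G H : Bundled.{0} L.Structure} (hG : G ∈ F) [Finite H] (hH : IsConn L H) {h : G → H}
    (hh : HomEmb L h) : H ∈ F :=
  hF.up G hG H inferInstance hH ⟨mkHom h fun r t => hh.hom r t fun _ => trivial,
    (isHomEmb_iff _).2 hh⟩

/-- The image of a connected structure is connected, so upward closure puts it back into `F`.
Badness is thereby always witnessed by a finite induced substructure, with no map to keep track of.
-/
theorem IsAdmissible.ind_range_mem [L.IsRelational] (hF : IsAdmissible F)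
    {G : Bundled.{0} L.Structure} (hG : G ∈ F) {h : G → A} (hh : HomEmb L h) :
    (Set.range h).Finite ∧
      (⟨ind L (Set.range h), inferInstance⟩ : Bundled.{0} L.Structure) ∈ F := by
  have := hF.finite G hG
  refine ⟨Set.finite_range h, ?_⟩
  have hk := hh.codRestrict (Set.range h) fun x => ⟨x, rfl⟩
  have hf : Finite (ind L (Set.range h)) := Set.finite_range h
  refine hF.mem_of_homEmb hG (H := ⟨ind L (Set.range h), inferInstance⟩)
    (IsConn.of_surjective hk ?_ (hF.conn G hG)) hk
  rintro ⟨_, x, rfl⟩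
  exact ⟨x, rfl⟩

/-- A bad structure has a finite induced substructure in `F`. -/
theorem IsAdmissible.exists_ind_mem [L.IsRelational] (hF : IsAdmissible F) (hA : Bad F A) :
    ∃ W : Set A, W.Finite ∧ (⟨ind L W, inferInstance⟩ : Bundled.{0} L.Structure) ∈ F := by
  obtain ⟨G, hG, h, hh⟩ := hA
  exact ⟨Set.range h, hF.ind_range_mem hG hh⟩

theorem IsAdmissible.exists_ind_mem_of_bad_ind [L.IsRelational] (hF : IsAdmissible F) {S : Set A}
    (hA : Bad F (ind L S)) : ∃ W ⊆ S, W.Finite ∧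
      (⟨ind L W, inferInstance⟩ : Bundled.{0} L.Structure) ∈ F := by
  obtain ⟨G, hG, h, hh⟩ := hA
  refine ⟨Set.range (indEmb L S ∘ h), ?_,
    hF.ind_range_mem hG ((homEmb_embedding (indEmb L S)).comp hh)⟩
  rintro _ ⟨x, rfl⟩
  exact (h x).2

end Basics

/-! ### Free amalgamation over roots -/

section Amalgams

variable {L : FirstOrder.Language.{u, v}} {n m : ℕ} {D : Type} [L.Structure D]

/-- Two rooted structures induce the same structure on their roots. -/
def SameRoots (P Q : Rooted L n) : Prop :=
  ∀ (k : ℕ) (r : L.Relations k) (τ : Fin k → Fin n),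
    RelMap r (P.root ∘ τ) ↔ RelMap r (Q.root ∘ τ)

/-- The same structure with only some of its roots, renumbered. -/
abbrev Rooted.reroot (P : Rooted L n) (σ : Fin m ↪ Fin n) : Rooted L m :=
  ⟨P.carrier, σ.trans P.root⟩

namespace SameRoots

variable {P Q R : Rooted L n}

theorem refl (P : Rooted L n) : SameRoots P P := fun _ _ _ => Iff.rfl

theorem symm (h : SameRoots P Q) : SameRoots Q P := fun k r τ => (h k r τ).symm

theorem trans (h : SameRoots P Q) (h' : SameRoots Q R) : SameRoots P R :=
  fun k r τ => (h k r τ).trans (h' k r τ)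

theorem reroot (h : SameRoots P Q) (σ : Fin m ↪ Fin n) :
    SameRoots (P.reroot σ) (Q.reroot σ) :=
  fun k r τ => h k r (σ ∘ τ)

theorem of_embeddings (f : P.carrier ↪[L] D) (g : Q.carrier ↪[L] D)
    (h : ∀ i, f (P.root i) = g (Q.root i)) : SameRoots P Q := fun k r τ => by
  rw [← f.map_rel r, ← g.map_rel r]
  exact iff_of_eq (congrArg _ (funext fun i => h (τ i)))

end SameRoots

namespace IsFreeAmalgam

variable {P Q : Rooted L n} {G : Type} [L.Structure G]
  {f : P.carrier ↪[L] G} {g : Q.carrier ↪[L] G}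

theorem symm (h : IsFreeAmalgam P Q f g) : IsFreeAmalgam Q P g f where
  root_eq i := (h.root_eq i).symm
  cover := by rw [Set.union_comm]; exact h.cover
  strong x y e := (h.strong y x e.symm).symm
  free k r t ht := (h.free k r t ht).symm

theorem sameRoots (h : IsFreeAmalgam P Q f g) : SameRoots P Q :=
  .of_embeddings f g h.root_eq

theorem mem_or (h : IsFreeAmalgam P Q f g) (x : G) : (∃ p, f p = x) ∨ ∃ q, g q = x :=
  (Set.ext_iff.1 h.cover x).2 trivial

theorem countable (h : IsFreeAmalgam P Q f g) [Countable P.carrier] [Countable Q.carrier] :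
    Countable G := by
  rw [← Set.countable_univ_iff, ← h.cover]
  exact (Set.countable_range f).union (Set.countable_range g)

theorem eq_root (h : IsFreeAmalgam P Q f g) {p : P.carrier} {q : Q.carrier} (e : f p = g q) :
    ∃ i, P.root i = p ∧ Q.root i = q := by
  obtain ⟨i, rfl⟩ := (h.strong p q e).1
  exact ⟨i, rfl, g.injective (by rw [← h.root_eq, e])⟩

/-- The universal property of free amalgamation. -/
theorem lift (h : IsFreeAmalgam P Q f g) {a : P.carrier → D} {b : Q.carrier → D}
    (ha : HomEmb L a) (hb : HomEmb L b) (hab : ∀ i, a (P.root i) = b (Q.root i)) :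
    ∃ c : G → D, HomEmb L c ∧ (∀ p, c (f p) = a p) ∧ ∀ q, c (g q) = b q := by
  classical
  have hex : ∀ x : G, ∃ d : D, (∀ p, f p = x → a p = d) ∧ ∀ q, g q = x → b q = d := by
    intro x
    rcases h.mem_or x with ⟨p, rfl⟩ | ⟨q, rfl⟩
    · refine ⟨a p, fun p' e => by rw [f.injective e], fun q e => ?_⟩
      obtain ⟨i, rfl, rfl⟩ := h.eq_root e.symm
      exact (hab i).symm
    · refine ⟨b q, fun p e => ?_, fun q' e => by rw [g.injective e]⟩
      obtain ⟨i, rfl, rfl⟩ := h.eq_root e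
      exact hab i
  choose c hca hcb using hex
  have h1 : ∀ p, c (f p) = a p := fun p => (hca _ p rfl).symm
  have h2 : ∀ q, c (g q) = b q := fun q => (hcb _ q rfl).symm
  refine ⟨c, HomEmbOn.glue (V := Set.range f) (W := Set.range g) (.of_comp_embedding f ?_)
    (.of_comp_embedding g ?_) h.free h.cover, h1, h2⟩
  · rwa [show c ∘ f = a from funext h1]
  · rwa [show c ∘ g = b from funext h2]

end IsFreeAmalgam

/-- The vertices are those of `P` together with the non-roots of `Q`; agreement on the roots is
exactly what makes both canonical maps embeddings. -/
theorem exists_amalgam [L.IsRelational] {P Q : Rooted L n} (h : SameRoots P Q) :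
    ∃ (A : Bundled.{0} L.Structure) (f : P.carrier ↪[L] A) (g : Q.carrier ↪[L] A),
      IsFreeAmalgam P Q f g := by
  classical
  let f₀ : P.carrier → P.carrier ⊕ {q : Q.carrier // q ∉ Set.range Q.root} := Sum.inl
  let g₀ : Q.carrier → P.carrier ⊕ {q : Q.carrier // q ∉ Set.range Q.root} := fun q =>
    if hq : q ∈ Set.range Q.root then Sum.inl (P.root hq.choose) else Sum.inr ⟨q, hq⟩
  have hroot : ∀ i, g₀ (Q.root i) = f₀ (P.root i) := by
    intro i
    have hi : Q.root i ∈ Set.range Q.root := ⟨i, rfl⟩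
    simp only [g₀, dif_pos hi]
    rw [Q.root.injective hi.choose_spec]
  have hinr : ∀ q (hq : q ∉ Set.range Q.root), g₀ q = Sum.inr ⟨q, hq⟩ := fun q hq => dif_neg hq
  have hf : Function.Injective f₀ := Sum.inl_injective
  have hstrong : ∀ p q, f₀ p = g₀ q → ∃ i, P.root i = p ∧ Q.root i = q := by
    intro p q e
    by_cases hq : q ∈ Set.range Q.root
    · obtain ⟨i, rfl⟩ := hq
      exact ⟨i, (hf (e.trans (hroot i))).symm, rfl⟩
    · rw [hinr q hq] at e
      exact (Sum.inl_ne_inr e).elim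
  have hg : Function.Injective g₀ := by
    intro q q' e
    by_cases hq : q ∈ Set.range Q.root
    · obtain ⟨i, rfl⟩ := hq
      rw [hroot] at e
      obtain ⟨j, hj, rfl⟩ := hstrong _ _ e
      rw [P.root.injective hj]
    · by_cases hq' : q' ∈ Set.range Q.root
      · obtain ⟨i, rfl⟩ := hq'
        rw [hroot] at e
        obtain ⟨j, hj, rfl⟩ := hstrong _ _ e.symm
        rw [P.root.injective hj]
      · rw [hinr q hq, hinr q' hq'] at e
        exact congrArg Subtype.val (Sum.inr_injective e)
  let _ : L.Structure (P.carrier ⊕ {q : Q.carrier // q ∉ Set.range Q.root}) :=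
    { funMap := fun f => isEmptyElim f
      RelMap := fun r t => (∃ s, RelMap r s ∧ f₀ ∘ s = t) ∨ ∃ s, RelMap r s ∧ g₀ ∘ s = t }
  have hrel : ∀ {k : ℕ} (r : L.Relations k) (t : Fin k → _), RelMap r t ↔
    (∃ s, RelMap r s ∧ f₀ ∘ s = t) ∨ ∃ s, RelMap r s ∧ g₀ ∘ s = t := fun _ _ => Iff.rfl
  refine ⟨⟨_, inferInstance⟩, mkEmb f₀ hf fun r t => ?_, mkEmb g₀ hg fun r t => ?_, ?_⟩
  · rw [hrel]
    refine ⟨?_, fun ht => Or.inl ⟨t, ht, rfl⟩⟩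
    rintro (⟨s, hs, e⟩ | ⟨s, hs, e⟩)
    · rwa [← hf.comp_left e]
    · choose τ hτ hτ' using fun i => hstrong (t i) (s i) (congrFun e i).symm
      obtain rfl : P.root ∘ τ = t := funext hτ
      obtain rfl : Q.root ∘ τ = s := funext hτ'
      exact (h _ r τ).2 hs
  · rw [hrel]
    refine ⟨?_, fun ht => Or.inr ⟨t, ht, rfl⟩⟩
    rintro (⟨s, hs, e⟩ | ⟨s, hs, e⟩)
    · choose τ hτ hτ' using fun i => hstrong (s i) (t i) (congrFun e i)
      obtain rfl : P.root ∘ τ = s := funext hτ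
      obtain rfl : Q.root ∘ τ = t := funext hτ'
      exact (h _ r τ).1 hs
    · rwa [← hg.comp_left e]
  · refine ⟨fun i => (hroot i).symm, Set.eq_univ_of_forall ?_, fun x y e => ?_, ?_⟩
    · rintro (p | ⟨q, hq⟩)
      · exact Or.inl ⟨p, rfl⟩
      · exact Or.inr ⟨q, hinr q hq⟩
    · obtain ⟨i, hi, hi'⟩ := hstrong x y e
      exact ⟨⟨i, hi⟩, ⟨i, hi'⟩⟩
    · rintro k r t (⟨s, -, rfl⟩ | ⟨s, -, rfl⟩)
      · exact Or.inl fun i => ⟨s i, rfl⟩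
      · exact Or.inr fun i => ⟨s i, rfl⟩

/-- `P` restricted to a set of vertices containing its roots. -/
abbrev Rooted.sub [L.IsRelational] (P : Rooted L n) (S : Set P.carrier)
    (h : ∀ i, P.root i ∈ S) : Rooted L n :=
  ⟨ind L S, ⟨fun i => ⟨P.root i, h i⟩, fun _ _ e => P.root.injective (congrArg Subtype.val e)⟩⟩

end Amalgams

/-! ### The Myhill–Nerode equivalence of rooted structures -/

section Clash

variable {L : FirstOrder.Language.{u, v}} (F : Set (Bundled.{0} L.Structure)) {n m : ℕ}

/-- The free amalgam of `P` and `Q` is defined and not in `Forb(F)`. -/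
def Clash (P Q : Rooted L n) : Prop :=
  ∃ (A : Bundled.{0} L.Structure) (f : P.carrier ↪[L] A) (g : Q.carrier ↪[L] A),
    IsFreeAmalgam P Q f g ∧ Bad F A

/-- The Myhill–Nerode equivalence of rooted structures. -/
structure Nerode (P Q : Rooted L n) : Prop where
  sameRoots : SameRoots P Q
  clash_iff : ∀ R, Clash F P R ↔ Clash F Q R

variable {F} {D : Type} [L.Structure D] {P P' Q R : Rooted L n}

theorem Clash.symm : Clash F P Q → Clash F Q P :=
  fun ⟨A, f, g, h, hA⟩ => ⟨A, g, f, h.symm, hA⟩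

theorem Clash.sameRoots : Clash F P Q → SameRoots P Q := fun ⟨_, _, _, h, _⟩ => h.sameRoots

theorem Clash.bad (h : Clash F P Q) {a : P.carrier → D} {b : Q.carrier → D}
    (ha : HomEmb L a) (hb : HomEmb L b) (hab : ∀ i, a (P.root i) = b (Q.root i)) : Bad F D := by
  obtain ⟨A, f, g, hA, hbad⟩ := h
  obtain ⟨c, hc, -⟩ := hA.lift ha hb hab
  exact hbad.map hc

theorem clash_of_forall [L.IsRelational] (h : SameRoots P Q)
    (hb : ∀ (A : Bundled.{0} L.Structure) (f : P.carrier ↪[L] A) (g : Q.carrier ↪[L] A),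
      IsFreeAmalgam P Q f g → Bad F A) : Clash F P Q := by
  obtain ⟨A, f, g, hA⟩ := exists_amalgam h
  exact ⟨A, f, g, hA, hb A f g hA⟩

/-- By the universal property, badness of `P ⊕ Q` passes to any structure receiving compatible maps
from `P` and `Q`. Reassociating iterated amalgams reduces to supplying such maps, without any
isomorphism between amalgams. -/
theorem Clash.map [L.IsRelational] {m : ℕ} {P Q : Rooted L n} (h : Clash F P Q) {P₁ Q₁ : Rooted L m}
    (hr : SameRoots P₁ Q₁)
    (hb : ∀ (A : Bundled.{0} L.Structure) (f : P₁.carrier ↪[L] A) (g : Q₁.carrier ↪[L] A),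
      IsFreeAmalgam P₁ Q₁ f g → ∃ (a : P.carrier → A) (b : Q.carrier → A), HomEmb L a ∧
        HomEmb L b ∧ ∀ i, a (P.root i) = b (Q.root i)) : Clash F P₁ Q₁ :=
  clash_of_forall hr fun A f g hA => by
    obtain ⟨a, b, ha, hb, hab⟩ := hb A f g hA
    exact h.bad ha hb hab

namespace Nerode

theorem refl (P : Rooted L n) : Nerode F P P := ⟨.refl P, fun _ => Iff.rfl⟩

theorem symm (h : Nerode F P Q) : Nerode F Q P :=
  ⟨h.sameRoots.symm, fun R => (h.clash_iff R).symm⟩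

theorem trans (h : Nerode F P Q) (h' : Nerode F Q R) : Nerode F P R :=
  ⟨h.sameRoots.trans h'.sameRoots, fun S => (h.clash_iff S).trans (h'.clash_iff S)⟩

theorem of_imp (hr : SameRoots P Q) (h : ∀ R, Clash F P R → Clash F Q R)
    (h' : ∀ R, Clash F Q R → Clash F P R) : Nerode F P Q := ⟨hr, fun R => ⟨h R, h' R⟩⟩

end Nerode

variable (F n) in
/-- The Myhill–Nerode equivalence as a setoid. -/
def nerodeSetoid : Setoid (Rooted L n) :=
  ⟨Nerode F, ⟨.refl, .symm, .trans⟩⟩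

variable [L.IsRelational]

/-- A test structure `R` on fewer roots becomes one on all roots by freely attaching to it the
structure that `P` induces on its roots; this structure is shared by `P` and `Q`. -/
theorem Nerode.reroot (h : Nerode F P Q) (σ : Fin m ↪ Fin n) :
    Nerode F (P.reroot σ) (Q.reroot σ) := by
  suffices key : ∀ {P Q : Rooted L n}, Nerode F P Q → ∀ R, Clash F (P.reroot σ) R →
      Clash F (Q.reroot σ) R from
    .of_imp (h.sameRoots.reroot σ) (key h) (key h.symm)
  clear! P Q
  intro P Q h R hR
  have h0 : ∀ i, P.root i ∈ Set.range P.root := fun i => ⟨i, rfl⟩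
  have hr0 : SameRoots ((P.sub _ h0).reroot σ) (P.reroot σ) := SameRoots.refl (P.reroot σ)
  obtain ⟨W, f, g, hW⟩ := exists_amalgam (hr0.trans hR.sameRoots)
  have hPW : SameRoots P ⟨W, (P.sub _ h0).root.trans f.toEmbedding⟩ :=
    SameRoots.of_embeddings (P := (P.sub _ h0)) (Q := ⟨W, (P.sub _ h0).root.trans f.toEmbedding⟩) f
      (.refl L W) fun i => rfl
  have hc : Clash F P ⟨W, (P.sub _ h0).root.trans f.toEmbedding⟩ :=
    hR.map hPW fun A a b hA => ⟨a, b ∘ g, homEmb_embedding _,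
      (homEmb_embedding b).comp (homEmb_embedding g), fun i => by
        have := hA.root_eq (σ i)
        have h2 := hW.root_eq i
        simp only [Function.comp]
        rw [← h2]
        exact this⟩
  refine ((h.clash_iff _).1 hc).map ((h.sameRoots.reroot σ).symm.trans hR.sameRoots) ?_
  intro A a b hA
  choose τ hτ using fun x : (P.sub _ h0).carrier => x.2
  have hτ' : ∀ i, τ ((P.sub _ h0).root i) = i := fun i => P.root.injective (hτ _)
  have he : ∀ {k : ℕ} (r : L.Relations k) (t : Fin k → (P.sub _ h0).carrier),
      RelMap r ((fun x => Q.root (τ x)) ∘ t) ↔ RelMap r t := by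
    intro k r t
    rw [← (indEmb L _).map_rel r t]
    have : (indEmb L (Set.range P.root)) ∘ t = P.root ∘ (τ ∘ t) :=
      funext fun i => (hτ (t i)).symm
    rw [this]
    exact (h.sameRoots _ r (τ ∘ t)).symm
  let e : (P.sub _ h0).carrier ↪[L] Q.carrier := mkEmb (fun x => Q.root (τ x)) (by
    intro x y hxy
    have := Q.root.injective hxy
    exact Subtype.ext (by rw [← hτ x, ← hτ y, this])) he
  obtain ⟨c, hc, hc1, hc2⟩ := hW.lift ((homEmb_embedding a).comp (homEmb_embedding e))
    (homEmb_embedding b) (fun i => by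
      rw [← hA.root_eq i]
      exact congrArg a (congrArg Q.root (hτ' (σ i))))
  refine ⟨a, c, homEmb_embedding a, hc, fun i => ?_⟩
  exact ((hc1 _).trans (congrArg a (congrArg Q.root (hτ' i)))).symm

omit [L.IsRelational] in
/-- The free amalgam of equivalent structures that are not bad is not bad. -/
theorem Nerode.not_bad_amalgam {A : Type} [L.Structure A] (h : Nerode F P Q)
    (hQ : ¬ Bad F Q.carrier) {f : P.carrier ↪[L] A} {g : Q.carrier ↪[L] A}
    (hA : IsFreeAmalgam P Q f g) : ¬ Bad F A := fun hbad =>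
  hQ (((h.clash_iff Q).1 ⟨⟨A, inferInstance⟩, f, g, hA, hbad⟩).bad
    (homEmb_embedding (.refl L _)) (homEmb_embedding (.refl L _)) fun _ => rfl)

/-- Free amalgamation over equivalent tuples preserves the equivalence classes of all tuples. -/
theorem Nerode.amalgam_left {A : Type} [L.Structure A] (h : Nerode F P Q)
    {f : P.carrier ↪[L] A} {g : Q.carrier ↪[L] A}
    (hA : IsFreeAmalgam P Q f g) (s : Fin m ↪ P.carrier) :
    Nerode F ⟨P.carrier, s⟩ ⟨A, s.trans f.toEmbedding⟩ := by
  have hs : SameRoots (⟨P.carrier, s⟩ : Rooted L m) ⟨A, s.trans f.toEmbedding⟩ :=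
    SameRoots.of_embeddings (P := ⟨P.carrier, s⟩) (Q := ⟨A, s.trans f.toEmbedding⟩) f
      (.refl L A) fun _ => rfl
  refine .of_imp hs (fun R hR => ?_) fun R hR => ?_
  · exact hR.map (hs.symm.trans hR.sameRoots) fun A' a b hA' =>
      ⟨a ∘ f, b, (homEmb_embedding a).comp (homEmb_embedding f), homEmb_embedding b, hA'.root_eq⟩
  -- With `V = P ⊕ R` over `s`, the badness of `A ⊕ R` makes `Q ⊕ V` bad. Equivalence turns this
  -- into `P ⊕ V`, which folds onto `V` because `V` already contains `P`.
  · refine clash_of_forall (hs.trans hR.sameRoots) fun V a b hV => ?_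
    have hPV : SameRoots P ⟨V, P.root.trans a.toEmbedding⟩ :=
      SameRoots.of_embeddings (P := P) (Q := ⟨V, P.root.trans a.toEmbedding⟩) a
        (.refl L V) fun _ => rfl
    have hc : Clash F Q ⟨V, P.root.trans a.toEmbedding⟩ := by
      refine hR.map (h.sameRoots.symm.trans hPV) fun Z q w hZ => ?_
      obtain ⟨c, hc, hc1, hc2⟩ := hA.lift ((homEmb_embedding w).comp (homEmb_embedding a))
        (homEmb_embedding q) fun i => (hZ.root_eq i).symm
      exact ⟨c, w ∘ b, hc, (homEmb_embedding w).comp (homEmb_embedding b), fun i =>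
        (hc1 (s i)).trans (congrArg w (hV.root_eq i))⟩
    exact ((h.clash_iff _).2 hc).bad (homEmb_embedding a) (homEmb_embedding (.refl L V))
      fun _ => rfl

/-- The equivalence is a congruence for free amalgamation over some of the roots. -/
theorem Nerode.glue {Q₁ Q₁' Q₂ Q₂' : Rooted L n} {R₁ R₂ : Rooted L m} {σ : Fin m ↪ Fin n}
    {f₁ : (Q₁'.reroot σ).carrier ↪[L] Q₁.carrier} {g₁ : R₁.carrier ↪[L] Q₁.carrier}
    (hf₁ : ∀ i, f₁ (Q₁'.root i) = Q₁.root i) (h₁ : IsFreeAmalgam (Q₁'.reroot σ) R₁ f₁ g₁)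
    {f₂ : (Q₂'.reroot σ).carrier ↪[L] Q₂.carrier} {g₂ : R₂.carrier ↪[L] Q₂.carrier}
    (hf₂ : ∀ i, f₂ (Q₂'.root i) = Q₂.root i) (h₂ : IsFreeAmalgam (Q₂'.reroot σ) R₂ f₂ g₂)
    (hQ : Nerode F Q₁' Q₂') (hR : Nerode F R₁ R₂) : Nerode F Q₁ Q₂ := by
  have hs : ∀ {Q Q' : Rooted L n} {f : Q'.carrier ↪[L] Q.carrier},
      (∀ i, f (Q'.root i) = Q.root i) → SameRoots Q Q' := fun {Q _ f} hf =>
    (SameRoots.of_embeddings f (.refl L Q.carrier) hf).symm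
  suffices key : ∀ {Q₁ Q₁' Q₂ Q₂' : Rooted L n} {R₁ R₂ : Rooted L m}
      {f₁ : (Q₁'.reroot σ).carrier ↪[L] Q₁.carrier} {g₁ : R₁.carrier ↪[L] Q₁.carrier}
      (_ : ∀ i, f₁ (Q₁'.root i) = Q₁.root i) (_ : IsFreeAmalgam (Q₁'.reroot σ) R₁ f₁ g₁)
      {f₂ : (Q₂'.reroot σ).carrier ↪[L] Q₂.carrier} {g₂ : R₂.carrier ↪[L] Q₂.carrier}
      (_ : ∀ i, f₂ (Q₂'.root i) = Q₂.root i) (_ : IsFreeAmalgam (Q₂'.reroot σ) R₂ f₂ g₂)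
      (_ : Nerode F Q₁' Q₂') (_ : Nerode F R₁ R₂), ∀ B, Clash F Q₁ B → Clash F Q₂ B from
    .of_imp ((hs hf₁).trans (hQ.sameRoots.trans (hs hf₂).symm)) (key hf₁ h₁ hf₂ h₂ hQ hR)
      (key hf₂ h₂ hf₁ h₁ hQ.symm hR.symm)
  intro Q₁ Q₁' Q₂ Q₂' R₁ R₂ f₁ g₁ hf₁ h₁ f₂ g₂ hf₂ h₂ hQ hR B hB
  have hB₁ : SameRoots Q₁' B := (hs hf₁).symm.trans hB.sameRoots
  have hB₂ : SameRoots Q₂' B := hQ.sameRoots.symm.trans hB₁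
  -- The two factors are exchanged one at a time. Moving `R₁` to the side of `B` gives `W = B ⊕ R₁`,
  -- against which `Q₁'` may be replaced by `Q₂'`.
  obtain ⟨W, b, r, hW⟩ := exists_amalgam ((hB₁.reroot σ).symm.trans h₁.sameRoots)
  have hBW : SameRoots B ⟨W, B.root.trans b.toEmbedding⟩ :=
    SameRoots.of_embeddings (P := B) (Q := ⟨W, B.root.trans b.toEmbedding⟩) b
      (.refl L W) fun _ => rfl
  have hc₁ : Clash F Q₁' ⟨W, B.root.trans b.toEmbedding⟩ := by
    refine hB.map (hB₁.trans hBW) fun V q w hV => ?_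
    obtain ⟨c, hc, hc1, hc2⟩ := h₁.lift (homEmb_embedding q)
      ((homEmb_embedding w).comp (homEmb_embedding r)) fun i =>
        (hV.root_eq (σ i)).trans (congrArg w (hW.root_eq i))
    refine ⟨c, w ∘ b, hc, (homEmb_embedding w).comp (homEmb_embedding b), fun i => ?_⟩
    rw [← hf₁ i, hc1]
    exact hV.root_eq i
  -- Now `B` moves to the other side: `R₁` is tested against `E = Q₂' ⊕ B` and may be replaced by
  -- `R₂`.
  obtain ⟨E, q, e, hE⟩ := exists_amalgam hB₂
  let E' : Rooted L m := ⟨E, (σ.trans Q₂'.root).trans q.toEmbedding⟩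
  have hE' : SameRoots (Q₂'.reroot σ) E' :=
    SameRoots.of_embeddings (P := Q₂'.reroot σ) (Q := E') q (.refl L E) fun _ => rfl
  have hc₂ : Clash F R₁ E' := by
    refine ((hQ.clash_iff _).1 hc₁).map
      (hR.sameRoots.trans (h₂.sameRoots.symm.trans hE')) fun V r' z hV => ?_
    obtain ⟨c, hc, hc1, hc2⟩ := hW.lift ((homEmb_embedding z).comp (homEmb_embedding e))
      (homEmb_embedding r') fun i =>
        (congrArg z (hE.root_eq (σ i)).symm).trans (hV.root_eq i).symm
    refine ⟨z ∘ q, c, (homEmb_embedding z).comp (homEmb_embedding q), hc, fun i => ?_⟩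
    exact (congrArg z (hE.root_eq i)).trans (hc1 _).symm
  refine ((hR.clash_iff _).1 hc₂).map ((hs hf₂).trans hB₂) fun V q' b' hV => ?_
  obtain ⟨c, hc, hc1, hc2⟩ := hE.lift ((homEmb_embedding q').comp (homEmb_embedding f₂))
    (homEmb_embedding b') fun i => (congrArg q' (hf₂ i)).trans (hV.root_eq i)
  exact ⟨q' ∘ g₂, c, (homEmb_embedding q').comp (homEmb_embedding g₂), hc, fun i =>
    (congrArg q' (h₂.root_eq i).symm).trans (hc1 _).symm⟩

/-- In width zero all structures that are not bad are equivalent. -/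
theorem nerode_of_width_zero (hF : IsAdmissible F) (hL : IsEmpty (L.Relations 0))
    {P Q : Rooted L 0} (hP : ¬ Bad F P.carrier) (hQ : ¬ Bad F Q.carrier) : Nerode F P Q := by
  have hs : ∀ P Q : Rooted L 0, SameRoots P Q := by
    intro P Q k r τ
    rcases Nat.eq_zero_or_pos k with rfl | hk
    · exact isEmptyElim r
    · exact (τ ⟨0, hk⟩).elim0
  have key : ∀ {P Q : Rooted L 0}, ¬ Bad F P.carrier → ∀ R, Clash F P R → Clash F Q R := by
    rintro P Q hP R ⟨A, f, g, hA, hbad⟩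
    refine clash_of_forall (hs Q R) fun A' f' g' _ => ?_
    suffices Bad F R.carrier from this.map (homEmb_embedding g')
    obtain ⟨W, -, hW⟩ := hF.exists_ind_mem hbad
    have hconn := isConn_iff.1 (hF.conn _ hW)
    -- Without roots the amalgam is a disjoint union, so the connected `W` lies on one side.
    have hsplit : (∀ x ∈ W, x ∈ Set.range f) ∨ ∀ x ∈ W, x ∈ Set.range g := by
      by_contra! hcon
      obtain ⟨⟨x, hx, hxf⟩, ⟨y, hy, hyg⟩⟩ := hcon
      have := hconn.2 {z | z.1 ∉ Set.range f} ⟨⟨x, hx⟩, hxf⟩ fun k r t ht i j hi hj => by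
        rcases hA.free k r (fun i => (t i).1) ht with h | h
        · exact hi (h i)
        · obtain ⟨p, hp⟩ := hj
          obtain ⟨q, hq⟩ := h j
          exact (hA.eq_root (hp.trans hq.symm)).choose.elim0
      rcases hA.mem_or y with h | h
      · exact (Set.ext_iff.1 this ⟨y, hy⟩).2 trivial h
      · exact hyg h
    have hbd : ∀ {X : Type} [L.Structure X] (e : X ↪[L] A), (∀ x ∈ W, x ∈ Set.range e) →
        Bad F X := by
      intro X _ e he
      obtain ⟨k, -⟩ := exists_embedding_factor (indEmb L W) e fun x => he x.1 x.2
      exact ⟨_, hW, k, homEmb_embedding k⟩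
    exact hsplit.elim (fun h => absurd (hbd f h) hP) (hbd g)
  exact .of_imp (hs P Q) (key hP) (key hQ)

/-- Clashes are witnessed on finite sets. -/
theorem Clash.exists_sub (hF : IsAdmissible F) (h : Clash F P Q) : ∃ W : Set P.carrier,
    W.Finite ∧ ∀ (S : Set P.carrier) (hS : ∀ i, P.root i ∈ S), W ⊆ S → Clash F (P.sub S hS) Q := by
  obtain ⟨A, f, g, hA, hbad⟩ := h
  obtain ⟨W, hWfin, hW⟩ := hF.exists_ind_mem hbad
  refine ⟨f ⁻¹' W, hWfin.preimage f.injective.injOn, fun S hS hWS => ?_⟩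
  -- The smaller amalgam is realized inside `A`, on a set that still contains the finite member `W`
  -- of `F`.
  let T : Set A := f '' S ∪ Set.range g
  have hg : ∀ q, g q ∈ T := fun q => Or.inr ⟨q, rfl⟩
  have hf : ∀ p : (P.sub S hS).carrier, f (indEmb L S p) ∈ T := fun p => Or.inl ⟨p.1, p.2, rfl⟩
  have hT : ∀ p, f p ∈ T → p ∈ S := by
    rintro p (⟨p', hp', e⟩ | ⟨q, hq⟩)
    · rwa [← f.injective e]
    · obtain ⟨i, rfl, -⟩ := hA.eq_root hq.symm
      exact hS i
  refine ⟨⟨ind L T, inferInstance⟩, codEmb (f.comp (indEmb L S)) T hf, codEmb g T hg,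
    ⟨fun i => Subtype.ext (hA.root_eq i), Set.eq_univ_of_forall ?_, ?_, fun k r t ht => ?_⟩, ?_⟩
  · rintro ⟨_, ⟨p, hp, rfl⟩ | ⟨q, rfl⟩⟩
    · exact Or.inl ⟨⟨p, hp⟩, rfl⟩
    · exact Or.inr ⟨q, rfl⟩
  · intro x y e
    obtain ⟨i, hi, hi'⟩ := hA.eq_root (congrArg Subtype.val e)
    exact ⟨⟨i, Subtype.ext hi⟩, ⟨i, hi'⟩⟩
  · rcases hA.free k r (fun i => (t i).1) ht with h | h
    · refine Or.inl fun i => ?_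
      obtain ⟨p, hp⟩ := h i
      exact ⟨⟨p, hT p (hp ▸ (t i).2)⟩, Subtype.ext hp⟩
    · refine Or.inr fun i => ?_
      obtain ⟨q, hq⟩ := h i
      exact ⟨q, Subtype.ext hq⟩
  · have hWT : ∀ x ∈ W, x ∈ T := by
      intro x hx
      rcases hA.mem_or x with ⟨p, rfl⟩ | ⟨q, rfl⟩
      · exact Or.inl ⟨p, hWS hx, rfl⟩
      · exact hg q
    exact ⟨_, hW, _, (homEmb_embedding (indEmb L W)).codRestrict T fun x => hWT x.1 x.2⟩

end Clash

/-! ### Components off a cut, and cutting a structure into a free amalgam -/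

section Components

variable {L : FirstOrder.Language.{u, v}} {A : Type} [L.Structure A]

/-- Every vertex sharing a tuple with a vertex of `K` lies in `K ∪ R`. -/
def ClosedOff (L : FirstOrder.Language.{u, v}) {A : Type} [L.Structure A] (R K : Set A) : Prop :=
  ∀ (k : ℕ) (r : L.Relations k) (t : Fin k → A), RelMap r t → ∀ i j, t i ∈ K → t j ∈ K ∪ R

theorem closedOff_nbhd (K : Set A) : ClosedOff L (nbhd L K) K := by
  intro k r t ht i j hi
  by_cases hj : t j ∈ K
  · exact Or.inl hj
  · exact Or.inr ⟨hj, t i, hi, fun e => hj (e ▸ hi), k, r, t, ht, ⟨j, rfl⟩, ⟨i, rfl⟩⟩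

theorem ClosedOff.nbhd_subset {R K : Set A} (h : ClosedOff L R K) : nbhd L K ⊆ R := by
  rintro x ⟨hx, y, hy, -, k, r, t, ht, ⟨i, rfl⟩, ⟨j, rfl⟩⟩
  exact (h k r t ht j i hy).resolve_left hx

/-- A description of components in terms of tuples. -/
structure Comp (L : FirstOrder.Language.{u, v}) {A : Type} [L.Structure A] (R C : Set A) :
    Prop where
  nonempty : C.Nonempty
  notMem : ∀ x ∈ C, x ∉ R
  closedOff : ClosedOff L R C
  minimal : ∀ K ⊆ C, K.Nonempty → ClosedOff L R K → K = C

theorem ClosedOff.reachable {R K : Set A} (hK : ClosedOff L R K) {x y : (Rᶜ : Set A)}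
    (h : ((gaifman L A).induce Rᶜ).Reachable x y) (hx : x.1 ∈ K) : y.1 ∈ K := by
  have := (SimpleGraph.reachable_iff_reflTransGen _ _).1 h
  clear h
  induction this with
  | refl => exact hx
  | @tail b c _ h ih =>
    obtain ⟨-, n, r, t, ht, ⟨i, hi⟩, ⟨j, hj⟩⟩ := h
    have hc := hK n r t ht i j (by rw [hi]; exact ih)
    rw [hj] at hc
    exact hc.resolve_right c.2

theorem closedOff_supp {R : Set A} (c : ((gaifman L A).induce Rᶜ).ConnectedComponent) :
    ClosedOff L R (Subtype.val '' c.supp) := by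
  rintro k r t ht i j ⟨x, hx, hxi⟩
  by_cases hj : t j ∈ R
  · exact Or.inr hj
  refine Or.inl ⟨⟨t j, hj⟩, ?_, rfl⟩
  by_cases e : t i = t j
  · convert hx
    exact e.symm.trans hxi.symm
  · rw [SimpleGraph.ConnectedComponent.mem_supp_iff] at hx ⊢
    rw [← hx, SimpleGraph.ConnectedComponent.eq]
    refine SimpleGraph.Adj.reachable ?_
    exact ⟨fun h => e (hxi.symm.trans h.symm), k, r, t, ht, ⟨j, rfl⟩, ⟨i, hxi.symm⟩⟩

theorem isComponent_iff {R C : Set A} : IsComponent L R C ↔ Comp L R C := by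
  constructor
  · rintro ⟨c, rfl⟩
    refine ⟨c.nonempty_supp.image _, ?_, closedOff_supp c, fun K hK ⟨x, hx⟩ hcl => ?_⟩
    · rintro _ ⟨x, -, rfl⟩
      exact x.2
    · refine hK.antisymm ?_
      rintro _ ⟨y, hy, rfl⟩
      obtain ⟨x', hx', rfl⟩ := hK hx
      exact hcl.reachable (SimpleGraph.ConnectedComponent.exact (hx'.trans hy.symm)) hx
  · intro h
    obtain ⟨x, hx⟩ := h.nonempty
    let x' : (Rᶜ : Set A) := ⟨x, h.notMem x hx⟩
    refine ⟨((gaifman L A).induce Rᶜ).connectedComponentMk x',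
      (h.minimal _ ?_ (SimpleGraph.ConnectedComponent.nonempty_supp _ |>.image _)
        (closedOff_supp _)).symm⟩
    rintro _ ⟨y, hy, rfl⟩
    exact h.closedOff.reachable (SimpleGraph.ConnectedComponent.exact hy).symm hx

theorem exists_comp {R : Set A} {x : A} (hx : x ∉ R) : ∃ C, Comp L R C ∧ x ∈ C :=
  ⟨_, isComponent_iff.1 ⟨((gaifman L A).induce Rᶜ).connectedComponentMk ⟨x, hx⟩, rfl⟩,
    ⟨x, hx⟩, rfl, rfl⟩

variable [L.IsRelational]

/-- Components of the complement of a union of components. -/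
theorem Comp.image_compl {R X : Set A} (hX : ClosedOff L R X)
    {Y : Set (ind L Xᶜ)} (hY : Comp L (Subtype.val ⁻¹' R) Y) :
    Comp L R (Subtype.val '' Y) ∧ nbhd L (Subtype.val '' Y) = Subtype.val '' nbhd L Y := by
  -- A tuple meeting `Y` avoids `X`: otherwise closedness of `X` would put its vertex of `Y` into `X
  -- ∪ R`.
  have key : ∀ {k : ℕ} (r : L.Relations k) (t : Fin k → A), RelMap r t → ∀ i,
      t i ∈ Subtype.val '' Y → ∃ s : Fin k → ind L Xᶜ, RelMap r s ∧ ∀ i, (s i).1 = t i := by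
    rintro k r t ht i ⟨y, hy, hyi⟩
    have hn : ∀ j, t j ∈ Xᶜ := fun j hj => by
      rcases hX k r t ht j i hj with h | h
      · exact y.2 (hyi ▸ h)
      · exact hY.notMem y hy (show y.1 ∈ R from hyi ▸ h)
    exact ⟨fun j => ⟨t j, hn j⟩, ht, fun _ => rfl⟩
  refine ⟨⟨hY.nonempty.image _, ?_, ?_, ?_⟩, ?_⟩
  · rintro _ ⟨y, hy, rfl⟩
    exact hY.notMem y hy
  · intro k r t ht i j hi
    obtain ⟨s, hs, hst⟩ := key r t ht i hi
    obtain ⟨y, hy, hyi⟩ := hi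
    obtain rfl : y = s i := Subtype.ext (hyi.trans (hst i).symm)
    rw [← hst j]
    exact (hY.closedOff k r s hs i j hy).imp (fun h => ⟨_, h, rfl⟩) id
  · intro K hK hne hcl
    have h1 : Subtype.val ⁻¹' K ⊆ Y := by
      intro x hx
      obtain ⟨y, hy, e⟩ := hK hx
      rwa [← Subtype.ext e]
    have h2 := hY.minimal _ h1 (by
      obtain ⟨x, hx⟩ := hne
      obtain ⟨y, hy, rfl⟩ := hK hx
      exact ⟨y, hx⟩) fun k r t ht i j hi => hcl k r (fun i => (t i).1) ht i j hi
    refine hK.antisymm ?_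
    rintro _ ⟨y, hy, rfl⟩
    exact (Set.ext_iff.1 h2 y).2 hy
  · ext x
    constructor
    · rintro ⟨hx, y, hy, hne, k, r, t, ht, ⟨i, rfl⟩, ⟨j, rfl⟩⟩
      obtain ⟨s, hs, hst⟩ := key r t ht j hy
      obtain ⟨y, hy, hyj⟩ := hy
      obtain rfl : y = s j := Subtype.ext (hyj.trans (hst j).symm)
      refine ⟨s i, ⟨fun h => hx ⟨_, h, hst i⟩, s j, hy, fun e => hne ?_, k, r, s, hs,
        ⟨i, rfl⟩, ⟨j, rfl⟩⟩, hst i⟩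
      rw [← hst i, ← hst j, e]
    · rintro ⟨x, ⟨hx, y, hy, hne, k, r, t, ht, ⟨i, rfl⟩, ⟨j, rfl⟩⟩, rfl⟩
      refine ⟨?_, (t j).1, ⟨_, hy, rfl⟩, fun e => hne (Subtype.ext e), k, r, fun i => (t i).1, ht,
        ⟨i, rfl⟩, ⟨j, rfl⟩⟩
      rintro ⟨z, hz, e⟩
      exact hx (Subtype.ext e ▸ hz)

/-- Cutting a structure along some of its vertices. -/
theorem isFreeAmalgam_cut {m : ℕ} (P : Rooted L m) {X : Set P.carrier} (hX : ∀ i, P.root i ∉ X)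
    (hcl : ClosedOff L (Set.range P.root) X) :
    IsFreeAmalgam (P.sub Xᶜ hX) (P.sub (X ∪ Set.range P.root) fun i => Or.inr ⟨i, rfl⟩)
      (indEmb L _) (indEmb L _) where
  root_eq _ := rfl
  cover := by
    refine Set.eq_univ_of_forall fun x => ?_
    by_cases hx : x ∈ X
    · exact Or.inr ⟨⟨x, Or.inl hx⟩, rfl⟩
    · exact Or.inl ⟨⟨x, hx⟩, rfl⟩
  strong x y e := by
    have e' : x.1 = y.1 := e
    obtain ⟨i, hi⟩ := y.2.resolve_left fun h => x.2 (e' ▸ h)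
    exact ⟨⟨i, Subtype.ext (hi.trans e'.symm)⟩, ⟨i, Subtype.ext hi⟩⟩
  free k r t ht := by
    by_cases h : ∃ i, t i ∈ X
    · obtain ⟨i, hi⟩ := h
      exact Or.inr fun j => ⟨⟨t j, hcl k r t ht i j hi⟩, rfl⟩
    · exact Or.inl fun j => ⟨⟨t j, fun hj => h ⟨j, hj⟩⟩, rfl⟩

end Components

/-! ### Finitely many classes when every component sees a proper subset of the roots -/

section FiniteIndex

variable {L : FirstOrder.Language.{u, v}} (F : Set (Bundled.{0} L.Structure)) {n m : ℕ}

/-- The Myhill–Nerode class of a rooted structure. -/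
def nerodeClass (P : Rooted L n) : Quotient (nerodeSetoid F n) := Quotient.mk _ P

variable {F}

theorem nerodeClass_eq {P Q : Rooted L n} : nerodeClass F P = nerodeClass F Q ↔ Nerode F P Q :=
  Quotient.eq (r := nerodeSetoid F n)

theorem finite_nerodeClass_image {Δ : Type*} [Finite Δ] (K : Set (Rooted L n)) (d : K → Δ)
    (h : ∀ P Q : K, d P = d Q → Nerode F P.1 Q.1) : (nerodeClass F '' K).Finite := by
  refine Set.finite_coe_iff.1 (Finite.of_injective (fun c => d ⟨_, c.2.choose_spec.1⟩) ?_)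
  intro c c' e
  refine Subtype.ext ?_
  rw [← c.2.choose_spec.2, ← c'.2.choose_spec.2]
  exact nerodeClass_eq.2 (h _ _ e)

/-- The atomic diagram of the roots. -/
def rootDiagram (P : Rooted L n) : Set (Σ k : (Σ k, L.Relations k), Fin k.1 → Fin n) :=
  {x | RelMap x.1.2 (P.root ∘ x.2)}

theorem SameRoots.of_rootDiagram {P Q : Rooted L n} (h : rootDiagram P = rootDiagram Q) :
    SameRoots P Q := fun k r τ => Set.ext_iff.1 h ⟨⟨k, r⟩, τ⟩

/-- An enumeration of a set of indices. -/
def enum (T : Finset (Fin n)) : Fin T.card ↪ Fin n := (T.orderEmbOfFin rfl).toEmbedding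

theorem range_enum (T : Finset (Fin n)) : Set.range (enum T) = T := T.range_orderEmbOfFin rfl

/-- All components of `Q` off the roots have their neighbourhoods in a given family. -/
def CompsIn (𝒯 : Finset (Finset (Fin n))) (Q : Rooted L n) : Prop :=
  ∀ Y, Comp L (Set.range Q.root) Y → ∃ T ∈ 𝒯, nbhd L Y = Q.root '' T

variable [L.IsRelational]

theorem nerode_of_range_root {P Q : Rooted L n} (h : SameRoots P Q)
    (hP : ∀ x, x ∈ Set.range P.root) (hQ : ∀ x, x ∈ Set.range Q.root) : Nerode F P Q := by
  have key : ∀ {P Q : Rooted L n}, SameRoots P Q → (∀ x, x ∈ Set.range P.root) →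
      ∀ R, Clash F P R → Clash F Q R := by
    intro P Q h hP R hR
    choose τ hτ using hP
    have hτ' : ∀ i, τ (P.root i) = i := fun i => P.root.injective (hτ _)
    let e : P.carrier ↪[L] Q.carrier := mkEmb (fun x => Q.root (τ x))
      (fun x y hxy => by rw [← hτ x, ← hτ y, Q.root.injective hxy]) fun {k} r t => by
        refine (h k r (τ ∘ t)).symm.trans (iff_of_eq (congrArg _ ?_))
        exact funext fun i => hτ (t i)
    refine hR.map (h.symm.trans hR.sameRoots) fun A f g hA => ⟨f ∘ e, g,
      (homEmb_embedding f).comp (homEmb_embedding e), homEmb_embedding g, fun i => ?_⟩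
    rw [← hA.root_eq]
    exact congrArg f (congrArg Q.root (hτ' i))
  exact .of_imp h (key h hP) (key h.symm hQ)

/-- The union of all components whose neighbourhood is exactly the roots in `T` splits off as a free
factor of width `T.card < n`, which has finitely many classes by `ih`. The remainder falls under
`𝒯`, and `Nerode.glue` recovers the class of the whole. Once `𝒯` is empty only the roots remain. -/
theorem finite_compsIn [Finite (Σ n, L.Relations n)]
    (ih : ∀ m < n, Finite (Quotient (nerodeSetoid F m))) (𝒯 : Finset (Finset (Fin n)))
    (h𝒯 : Finset.univ ∉ 𝒯) : (nerodeClass F '' {Q | CompsIn 𝒯 Q}).Finite := by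
  induction 𝒯 using Finset.induction_on with
  | empty =>
    refine finite_nerodeClass_image _ (fun Q => rootDiagram Q.1) fun P Q h => ?_
    have key : ∀ Q : Rooted L n, CompsIn ∅ Q → ∀ x, x ∈ Set.range Q.root := by
      intro Q hQ x
      by_contra hx
      obtain ⟨C, hC, -⟩ := exists_comp (L := L) hx
      obtain ⟨T, hT, -⟩ := hQ C hC
      simp at hT
    exact nerode_of_range_root (.of_rootDiagram h) (key _ P.2) (key _ Q.2)
  | insert T 𝒯 hT𝒯 ih𝒯 =>
    rw [Finset.mem_insert, not_or] at h𝒯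
    have hTn : T.card < n := by
      have := (Finset.card_lt_iff_ne_univ T).2 (Ne.symm h𝒯.1)
      rwa [Fintype.card_fin] at this
    have := ih _ hTn
    have := (ih𝒯 h𝒯.2).to_subtype
    let X : ∀ Q : Rooted L n, Set Q.carrier := fun Q =>
      {x | ∃ Y, Comp L (Set.range Q.root) Y ∧ nbhd L Y = Q.root '' T ∧ x ∈ Y}
    have hX : ∀ (Q : Rooted L n) (i), Q.root i ∉ X Q := by
      rintro Q i ⟨Y, hY, -, hi⟩
      exact hY.notMem _ hi ⟨i, rfl⟩
    have hcl : ∀ Q : Rooted L n, ClosedOff L (Set.range (Q.reroot (enum T)).root) (X Q) := by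
      rintro Q k r t ht i j ⟨Y, hY, hYT, hi⟩
      refine (closedOff_nbhd Y k r t ht i j hi).imp (fun h => ⟨Y, hY, hYT, h⟩) fun h => ?_
      rw [hYT] at h
      obtain ⟨l, hl, e⟩ := h
      rw [← range_enum T] at hl
      obtain ⟨l, rfl⟩ := hl
      exact ⟨l, e⟩
    have hcl' : ∀ Q : Rooted L n, ClosedOff L (Set.range Q.root) (X Q) := by
      intro Q k r t ht i j hi
      refine (hcl Q k r t ht i j hi).imp id ?_
      rintro ⟨l, hl⟩
      exact ⟨_, hl⟩
    have hsub : ∀ Q : Rooted L n, CompsIn (insert T 𝒯) Q → CompsIn 𝒯 (Q.sub (X Q)ᶜ (hX Q)) := by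
      intro Q hQ Y hY
      have hr : Set.range (Q.sub (X Q)ᶜ (hX Q)).root = Subtype.val ⁻¹' Set.range Q.root := by
        ext x
        exact ⟨fun ⟨i, hi⟩ => ⟨i, congrArg Subtype.val hi⟩, fun ⟨i, hi⟩ => ⟨i, Subtype.ext hi⟩⟩
      rw [hr] at hY
      obtain ⟨hY1, hY2⟩ := Comp.image_compl (hcl' Q) hY
      obtain ⟨S, hS, hYS⟩ := hQ _ hY1
      rcases Finset.mem_insert.1 hS with rfl | hS
      · obtain ⟨y, hy⟩ := hY.nonempty
        exact absurd ⟨_, hY1, hYS, ⟨y, hy, rfl⟩⟩ y.2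
      · refine ⟨S, hS, Subtype.val_injective.image_injective ?_⟩
        rw [← hY2, hYS, ← Set.image_comp]
        rfl
    refine finite_nerodeClass_image (Δ := (nerodeClass F '' {Q | CompsIn 𝒯 Q}) ×
        Quotient (nerodeSetoid F T.card)) _
      (fun Q => (⟨_, _, hsub Q.1 Q.2, rfl⟩, nerodeClass F ((Q.1.reroot (enum T)).sub
        (X Q.1 ∪ Set.range (Q.1.reroot (enum T)).root) fun i => Or.inr ⟨i, rfl⟩))) ?_
    intro P Q h
    rw [Prod.mk.injEq] at h
    exact Nerode.glue (σ := enum T) (fun i => rfl)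
      (isFreeAmalgam_cut (P.1.reroot (enum T)) (fun i => hX P.1 (enum T i)) (hcl P.1)) (fun i => rfl)
      (isFreeAmalgam_cut (Q.1.reroot (enum T)) (fun i => hX Q.1 (enum T i)) (hcl Q.1))
      (nerodeClass_eq.1 (congrArg Subtype.val h.1)) (nerodeClass_eq.1 h.2)

end FiniteIndex

/-! ### Regularity implies finite Myhill–Nerode index -/

section Swap

variable {L : FirstOrder.Language.{u, v}} [L.IsRelational] {F : Set (Bundled.{0} L.Structure)}
  {n m : ℕ}

omit [L.IsRelational] in
-- Regularity concerns widths `n ≥ 1` only; in width zero a component with empty neighbourhood is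
-- the whole connected structure, leaving no second component.
theorem isEmpty_piece_zero (hF : IsAdmissible F) : IsEmpty (Piece F 0) := by
  refine ⟨fun p => ?_⟩
  obtain ⟨P, G, hG, R, C₁, C₂, e, ⟨h₁, h₂, hne, hn₁, hn₂⟩, -, hr⟩ := p
  refine hne ?_
  have hR : R = ∅ := by rw [← hr]; exact Set.range_eq_empty _
  have key : ∀ C, IsComponent L R C → nbhd L C = R → C = Set.univ := by
    intro C hC hn
    refine (isConn_iff.1 (hF.conn G hG)).2 C (isComponent_iff.1 hC).nonempty
      fun k r t ht i j hi => ?_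
    have := closedOff_nbhd C k r t ht i j hi
    rwa [hn, hR, Set.union_empty] at this
  rw [key _ h₁ hn₁, key _ h₂ hn₂]

/-- The invariants of a rooted structure that determine its Myhill–Nerode class. -/
structure SameData (F : Set (Bundled.{0} L.Structure)) (P Q : Rooted L n) : Prop where
  sameRoots : SameRoots P Q
  reroot : ∀ T : Finset (Fin n), T ≠ Finset.univ →
    Nerode F (P.reroot (enum T)) (Q.reroot (enum T))
  piece : ∀ (p : Piece F n) (h : p.1.carrier → P.carrier), HomEmb L h →
    (∀ i, h (p.1.root i) = P.root i) → ∃ (p' : Piece F n) (h' : p'.1.carrier → Q.carrier),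
      incompatible F p'.1 = incompatible F p.1 ∧ HomEmb L h' ∧ ∀ i, h' (p'.1.root i) = Q.root i
  test : ∀ R : Rooted L n, CompsIn (Finset.univ.erase Finset.univ) R → Clash F P R → Clash F Q R

/-- The component `X` of `z` in `W` minus the roots of `B` lies in `B`, so `B` clashes with `W`
minus `X` over the roots that `X` sees. The data allow `B` to be replaced by `B'`, or by a piece
mapping to `B'`, and both map into `E`. Hence `E` together with `W` minus `X` is already bad, and
`z` is no longer needed. -/
theorem SameData.exists_smaller {B B' E : Rooted L n} (hd : SameData F B B')
    {d : B'.carrier → E.carrier} (hdE : HomEmb L d) (hdr : ∀ i, d (B'.root i) = E.root i)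
    {C : Type} [L.Structure C] {f : B.carrier ↪[L] C} {g : E.carrier ↪[L] C}
    (hC : IsFreeAmalgam B E f g) {W : Set C}
    (hW : (⟨ind L W, inferInstance⟩ : Bundled.{0} L.Structure) ∈ F)
    (hWg : ¬ W ⊆ Set.range g) :
    ∃ z ∈ W, z ∉ Set.range g ∧ Bad F (ind L (Set.range g ∪ W \ {z})) := by
  obtain ⟨z, hz, hzg⟩ := Set.not_subset.1 hWg
  refine ⟨z, hz, hzg, ?_⟩
  set S : Set C := Set.range g ∪ W \ {z} with hS
  let R : Set (ind L W) := {x | ∃ i, f (B.root i) = x.1}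
  have hzR : (⟨z, hz⟩ : ind L W) ∉ R := fun ⟨i, hi⟩ => hzg ⟨E.root i, (hC.root_eq i).symm.trans hi⟩
  obtain ⟨X, hX, hzX⟩ := exists_comp (L := L) hzR
  have hXg : ∀ x ∈ X, x.1 ∉ Set.range g := by
    have := hX.minimal {x ∈ X | x.1 ∉ Set.range g} (Set.sep_subset _ _) ⟨_, hzX, hzg⟩ (by
      rintro k r t ht i j ⟨hi, hig⟩
      refine or_iff_not_imp_right.2 fun hj => ⟨(hX.closedOff k r t ht i j hi).resolve_right hj, ?_⟩
      rintro ⟨q, hq⟩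
      obtain ⟨p, hp⟩ := (hC.free k r (fun i => (t i).1) ht).resolve_right (fun h => hig (h i)) j
      obtain ⟨l, rfl, -⟩ := hC.eq_root (hp.trans hq.symm)
      exact hj ⟨l, hp⟩)
    intro x hx
    rw [← this] at hx
    exact hx.2
  have hXf : ∀ x ∈ X, ∃ b, f b = x.1 := fun x hx => (hC.mem_or x.1).resolve_right (hXg x hx)
  -- the roots seen by `X` and the resulting cut
  have hroot : ∀ {m : ℕ} (σ : Fin m ↪ Fin n), (∀ x, x ∈ nbhd L X ↔ ∃ i, f (B.root (σ i)) = x.1) →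
      (∀ i, f (B.root (σ i)) ∈ W) → ∃ ρ : Fin m ↪ ind L W, (∀ i, (ρ i).1 = f (B.root (σ i))) ∧
        (∀ i, ρ i ∉ X) ∧ Set.range ρ = nbhd L X ∧ ClosedOff L (Set.range ρ) X := by
    intro m σ hσ hσW
    have hr : Set.range (fun i => (⟨f (B.root (σ i)), hσW i⟩ : ind L W)) = nbhd L X := by
      ext x
      rw [hσ]
      exact ⟨fun ⟨i, hi⟩ => ⟨i, congrArg Subtype.val hi⟩, fun ⟨i, hi⟩ => ⟨i, Subtype.ext hi⟩⟩
    refine ⟨⟨fun i => ⟨f (B.root (σ i)), hσW i⟩, fun i j e =>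
      σ.injective (B.root.injective (f.injective (congrArg Subtype.val e)))⟩, fun i => rfl,
      fun i hi => hX.notMem _ hi ⟨σ i, rfl⟩, hr, ?_⟩
    change ClosedOff L (Set.range (fun i => (⟨f (B.root (σ i)), hσW i⟩ : ind L W))) X
    rw [hr]
    exact closedOff_nbhd X
  -- the part of `W` outside `X`, and the part inside, which embeds into `B`
  have hin : ∀ {m : ℕ} (σ : Fin m ↪ Fin n) (ρ : Fin m ↪ ind L W)
      (_ : ∀ i, (ρ i).1 = f (B.root (σ i))),
      ∃ k : ind L (X ∪ Set.range ρ) ↪[L] B.carrier, ∀ x, f (k x) = x.1.1 := by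
    intro m σ ρ hρ
    refine exists_embedding_factor ((indEmb L W).comp (indEmb L _)) f ?_
    rintro ⟨x, hx | ⟨i, rfl⟩⟩
    · exact hXf x hx
    · exact ⟨_, (hρ i).symm⟩
  have hclash : ∀ {m : ℕ} (σ : Fin m ↪ Fin n) (ρ : Fin m ↪ ind L W)
      (_ : ∀ i, (ρ i).1 = f (B.root (σ i))) (hρX : ∀ i, ρ i ∉ X)
      (_ : ClosedOff L (Set.range ρ) X),
      Clash F (B.reroot σ) ((⟨ind L W, ρ⟩ : Rooted L m).sub Xᶜ hρX) := by
    intro m σ ρ hρ hρX hcl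
    obtain ⟨k, hk⟩ := hin σ ρ hρ
    have hcut := (isFreeAmalgam_cut (⟨ind L W, ρ⟩ : Rooted L m) hρX hcl).symm
    have hc : Clash F _ _ := ⟨⟨ind L W, inferInstance⟩, _, _, hcut, _, hW, id,
      homEmb_embedding (.refl L _)⟩
    refine hc.map (SameRoots.of_embeddings (P := B.reroot σ)
      (Q := (⟨ind L W, ρ⟩ : Rooted L m).sub Xᶜ hρX) f
      ((indEmb L W).comp (indEmb L Xᶜ)) fun i => (hρ i).symm) fun A a b hA =>
      ⟨a ∘ k, b, (homEmb_embedding a).comp (homEmb_embedding k), homEmb_embedding b, fun i => ?_⟩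
    refine Eq.trans (congrArg a (f.injective ?_)) (hA.root_eq i)
    exact (hk _).trans (hρ i)
  have hfin : ∀ {m : ℕ} (σ : Fin m ↪ Fin n) (ρ : Fin m ↪ ind L W)
      (_ : ∀ i, (ρ i).1 = f (B.root (σ i))) (hρX : ∀ i, ρ i ∉ X) (P : Rooted L m)
      (p : P.carrier → E.carrier) (_ : HomEmb L p) (_ : ∀ i, p (P.root i) = E.root (σ i)),
      Clash F P ((⟨ind L W, ρ⟩ : Rooted L m).sub Xᶜ hρX) → Bad F (ind L S) := by
    intro m σ ρ hρ hρX P p hp hpr hc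
    refine hc.bad (((homEmb_embedding g).comp hp).codRestrict S fun x => Or.inl ⟨_, rfl⟩)
      ((homEmb_embedding ((indEmb L W).comp (indEmb L Xᶜ))).codRestrict S fun x =>
        Or.inr ⟨x.1.2, fun e => x.2 ?_⟩) fun i => Subtype.ext ?_
    · have : x.1 = ⟨z, hz⟩ := Subtype.ext e
      rw [this]
      exact hzX
    · refine (congrArg g (hpr i)).trans ((hC.root_eq (σ i)).symm.trans (hρ i).symm)
  classical
  have hNR : nbhd L X ⊆ R := hX.closedOff.nbhd_subset
  let T : Finset (Fin n) := Finset.univ.filter fun i => ∃ x ∈ nbhd L X, f (B.root i) = x.1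
  have hT : ∀ i, i ∈ T ↔ ∃ x ∈ nbhd L X, f (B.root i) = x.1 := fun i => by simp [T]
  by_cases hTu : T = Finset.univ
  · have hall : ∀ i, ∃ x ∈ nbhd L X, f (B.root i) = x.1 := fun i =>
      (hT i).1 (hTu ▸ Finset.mem_univ i)
    have hXR : nbhd L X = R := hNR.antisymm fun x ⟨i, hi⟩ => by
      obtain ⟨y, hy, e⟩ := hall i
      rwa [← Subtype.ext (hi.symm.trans e)] at hy
    obtain ⟨ρ, hρ, hρX, hρr, hcl⟩ := hroot (.refl (Fin n)) (fun x => by rw [hXR]; rfl) (fun i => by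
      obtain ⟨x, -, e⟩ := hall i
      exact e ▸ x.2)
    have hc := hclash _ ρ hρ hρX hcl
    -- Here `X` sees all roots. A second such component makes `X ∪ R` a piece; without one, every
    -- component left after removing `X` sees a proper subset of the roots, so that `SameData.test`
    -- applies.
    by_cases hYn : ∃ Y, Comp L R Y ∧ Y ≠ X ∧ nbhd L Y = R
    · obtain ⟨Y, hY, hYX, hYR⟩ := hYn
      let p : Piece F n := ⟨(⟨ind L W, ρ⟩ : Rooted L n).sub (X ∪ Set.range ρ)
        fun i => Or.inr ⟨i, rfl⟩, _, hW, R, X, Y, indEmb L _,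
          ⟨isComponent_iff.2 hX, isComponent_iff.2 hY, hYX.symm, hXR, hYR⟩,
          (range_indEmb _).trans (by rw [hρr, hXR]), hρr.trans hXR⟩
      obtain ⟨k, hk⟩ := hin _ ρ hρ
      obtain ⟨p', h', hinc, hh', hr'⟩ := hd.piece p k (homEmb_embedding k)
        fun i => f.injective ((hk _).trans (hρ i))
      have hQ : (⟨ind L W, ρ⟩ : Rooted L n).sub Xᶜ hρX ∈ incompatible F p.1 :=
        ⟨_, hW, _, _, (isFreeAmalgam_cut (⟨ind L W, ρ⟩ : Rooted L n) hρX hcl).symm⟩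
      rw [← hinc] at hQ
      obtain ⟨G, hG, a, b, hab⟩ := hQ
      exact hfin _ ρ hρ hρX p'.1 (d ∘ h') (hdE.comp hh')
        (fun i => (congrArg d (hr' i)).trans (hdr i))
        ⟨G, a, b, hab, G, hG, id, homEmb_embedding (.refl L _)⟩
    · refine hfin _ ρ hρ hρX B' d hdE hdr (hd.test _ ?_ hc)
      intro Y hY
      have hr : Set.range ((⟨ind L W, ρ⟩ : Rooted L n).sub Xᶜ hρX).root = Subtype.val ⁻¹' R := by
        rw [← hXR, ← hρr]
        ext x
        exact ⟨fun ⟨i, hi⟩ => ⟨i, congrArg Subtype.val hi⟩, fun ⟨i, hi⟩ => ⟨i, Subtype.ext hi⟩⟩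
      have hY' := hY
      rw [hr] at hY'
      obtain ⟨hY1, hY2⟩ := Comp.image_compl hX.closedOff hY'
      let V : Finset (Fin n) := Finset.univ.filter fun i =>
        ((⟨ind L W, ρ⟩ : Rooted L n).sub Xᶜ hρX).root i ∈ nbhd L Y
      have hV : nbhd L Y = ((⟨ind L W, ρ⟩ : Rooted L n).sub Xᶜ hρX).root '' V := by
        ext x
        constructor
        · intro hx
          obtain ⟨i, rfl⟩ := hY.closedOff.nbhd_subset hx
          exact ⟨i, Finset.mem_coe.2 (Finset.mem_filter.2 ⟨Finset.mem_univ i, hx⟩), rfl⟩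
        · rintro ⟨i, hi, rfl⟩
          exact (Finset.mem_filter.1 (Finset.mem_coe.1 hi)).2
      refine ⟨V, Finset.mem_erase.2 ⟨fun hVu => hYn ⟨_, hY1, ?_, ?_⟩, Finset.mem_univ _⟩, hV⟩
      · intro e
        obtain ⟨y, hy⟩ := hY.nonempty
        have hyX : y.1 ∈ Subtype.val '' Y := ⟨y, hy, rfl⟩
        rw [e] at hyX
        exact y.2 hyX
      · rw [hY2, hV, hVu, Finset.coe_univ, Set.image_univ, hr]
        refine Set.image_preimage_eq_of_subset fun x hx => ?_
        exact ⟨⟨x, fun hxX => hX.notMem x hxX hx⟩, rfl⟩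
  · have hTe : ∀ i, enum T i ∈ T := fun i => by
      have : enum T i ∈ Set.range (enum T) := ⟨i, rfl⟩
      rwa [range_enum] at this
    obtain ⟨ρ, hρ, hρX, hρr, hcl⟩ := hroot (enum T) (fun x => by
      constructor
      · intro hx
        obtain ⟨i, hi⟩ := hNR hx
        have : i ∈ Set.range (enum T) := by
          rw [range_enum]
          exact Finset.mem_coe.2 ((hT i).2 ⟨x, hx, hi⟩)
        obtain ⟨l, rfl⟩ := this
        exact ⟨l, hi⟩
      · rintro ⟨i, hi⟩
        obtain ⟨y, hy, e⟩ := (hT _).1 (hTe i)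
        rwa [← Subtype.ext (hi.symm.trans e)] at hy) (fun i => by
        obtain ⟨x, -, e⟩ := (hT _).1 (hTe i)
        exact e ▸ x.2)
    exact hfin _ ρ hρ hρX (B'.reroot (enum T)) d hdE (fun i => hdr _)
      (((hd.reroot T hTu).clash_iff _).1 (hclash _ ρ hρ hρX hcl))

/-- Each application of `SameData.exists_smaller` yields a member of `F` with fewer vertices outside
`E`, until one lies inside `E`. -/
theorem SameData.bad_of_bad_amalgam (hF : IsAdmissible F) {B B' E : Rooted L n}
    (hd : SameData F B B')
    {d : B'.carrier → E.carrier} (hdE : HomEmb L d) (hdr : ∀ i, d (B'.root i) = E.root i)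
    {C : Type} [L.Structure C] {f : B.carrier ↪[L] C} {g : E.carrier ↪[L] C}
    (hC : IsFreeAmalgam B E f g) (hbad : Bad F C) : Bad F E.carrier := by
  obtain ⟨W, hWf, hW⟩ := hF.exists_ind_mem hbad
  induction h : (W \ Set.range g).ncard using Nat.strong_induction_on generalizing W with
  | _ N ih =>
    by_cases hWg : W ⊆ Set.range g
    · obtain ⟨k, -⟩ := exists_embedding_factor (indEmb L W) g fun x => hWg x.2
      exact ⟨_, hW, k, homEmb_embedding k⟩
    · obtain ⟨z, hz, hzg, hb⟩ := hd.exists_smaller hdE hdr hC hW hWg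
      obtain ⟨V, hVS, hVf, hV⟩ := hF.exists_ind_mem_of_bad_ind hb
      refine ih _ ?_ V hVf hV rfl
      rw [← h]
      refine Set.ncard_lt_ncard ⟨fun x hx => ?_, fun hsub => ?_⟩ (hWf.subset Set.sdiff_subset)
      · exact ⟨((hVS hx.1).resolve_left hx.2).1, hx.2⟩
      · exact ((hVS (hsub ⟨hz, hzg⟩).1).resolve_left hzg).2 rfl

/-- Gluing a copy of `B` onto the roots of `D = B' ⊕ Q` makes the result bad, since it receives `B ⊕
Q`. As `B'` is present in `D`, the extra copy can be removed again. -/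
theorem SameData.clash (hF : IsAdmissible F) {B B' Q : Rooted L n} (hd : SameData F B B')
    (h : Clash F B Q) : Clash F B' Q := by
  refine clash_of_forall (hd.sameRoots.symm.trans h.sameRoots) fun D b q hD => ?_
  let E : Rooted L n := ⟨D, B'.root.trans b.toEmbedding⟩
  have hBE : SameRoots B E := hd.sameRoots.trans
    (SameRoots.of_embeddings (P := B') (Q := E) b (.refl L D) fun _ => rfl)
  obtain ⟨C, f, g, hC⟩ := exists_amalgam hBE
  refine hd.bad_of_bad_amalgam hF (E := E) (homEmb_embedding b) (fun _ => rfl) hC ?_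
  exact h.bad (homEmb_embedding f) ((homEmb_embedding g).comp (homEmb_embedding q))
    fun i => (hC.root_eq i).trans (congrArg g (hD.root_eq i))

/-- For a regular family, the Myhill–Nerode equivalence has finite index in every width. -/
theorem IsRegular.finite_nerode [Finite (Σ n, L.Relations n)] (hF : IsAdmissible F)
    (hreg : IsRegular F) (n : ℕ) : Finite (Quotient (nerodeSetoid F n)) := by
  induction n using Nat.strong_induction_on with
  | _ n ih =>
    have hp : Finite (Quotient (pieceEquiv F n)) := by
      rcases Nat.eq_zero_or_pos n with rfl | hn
      · have := isEmpty_piece_zero hF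
        infer_instance
      · exact hreg n hn
    -- The family consists of all proper subsets of the roots.
    have hK := (finite_compsIn ih (Finset.univ.erase Finset.univ)
      (Finset.notMem_erase _ _)).to_subtype
    have hT : ∀ T : {T : Finset (Fin n) // T ≠ Finset.univ},
        Finite (Quotient (nerodeSetoid F T.1.card)) := fun T => ih _ (by
      have := (Finset.card_lt_iff_ne_univ T.1).2 T.2
      rwa [Fintype.card_fin] at this)
    -- Together with the root diagram, `d₁`, `d₂`, `d₃` record the fields of `SameData`, each as a
    -- value in a finite set.
    let d₁ := fun (P : Rooted L n) (T : {T : Finset (Fin n) // T ≠ Finset.univ}) =>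
      nerodeClass F (P.reroot (enum T.1))
    let d₂ := fun P : Rooted L n => {c : Quotient (pieceEquiv F n) | ∃ p : Piece F n,
      Quotient.mk _ p = c ∧ ∃ h : p.1.carrier → P.carrier, HomEmb L h ∧
        ∀ i, h (p.1.root i) = P.root i}
    let d₃ := fun P : Rooted L n => {c : nerodeClass F '' {Q : Rooted L n | CompsIn
      (Finset.univ.erase Finset.univ) Q} | ∃ Q, nerodeClass F Q = c.1 ∧ Clash F P Q}
    have hdata : ∀ P Q : Rooted L n, rootDiagram P = rootDiagram Q → d₁ P = d₁ Q → d₂ P = d₂ Q →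
        d₃ P = d₃ Q → SameData F P Q := by
      intro P Q h₀ h₁ h₂ h₃
      refine ⟨.of_rootDiagram h₀, fun T hT => nerodeClass_eq.1 (congrFun h₁ ⟨T, hT⟩), ?_, ?_⟩
      · intro p h hh hr
        have : Quotient.mk _ p ∈ d₂ Q := h₂ ▸ ⟨p, rfl, h, hh, hr⟩
        obtain ⟨p', hp', h', hh', hr'⟩ := this
        exact ⟨p', h', Quotient.exact hp', hh', hr'⟩
      · intro R hR hc
        have : ⟨_, R, hR, rfl⟩ ∈ d₃ Q := h₃ ▸ ⟨R, rfl, hc⟩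
        obtain ⟨R', hR', hc'⟩ := this
        exact ((nerodeClass_eq.1 hR').clash_iff Q |>.1 hc'.symm).symm
    have := finite_nerodeClass_image (F := F) (Set.univ : Set (Rooted L n))
      (fun P => (rootDiagram P.1, d₁ P.1, d₂ P.1, d₃ P.1)) fun P Q h => by
        simp only [Prod.mk.injEq] at h
        have h1 := hdata _ _ h.1 h.2.1 h.2.2.1 h.2.2.2
        have h2 := hdata _ _ h.1.symm h.2.1.symm h.2.2.1.symm h.2.2.2.symm
        exact .of_imp h1.sameRoots (fun R => h1.clash hF) fun R => h2.clash hF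
    refine Set.finite_univ_iff.1 (this.subset fun c _ => ?_)
    obtain ⟨P, rfl⟩ := Quotient.mk_surjective (s := nerodeSetoid F n) c
    exact ⟨P, trivial, rfl⟩

end Swap

/-! ### A countable generic structure -/

section Generic

variable {L : FirstOrder.Language.{u, v}} {F : Set (Bundled.{0} L.Structure)} {n m : ℕ}

/-- An embedding preserving the Myhill–Nerode class of every tuple. -/
def IsTypeEmb (F : Set (Bundled.{0} L.Structure)) {A B : Type} [L.Structure A] [L.Structure B]
    (f : A ↪[L] B) : Prop :=
  ∀ (n : ℕ) (s : Fin n ↪ A), Nerode F ⟨A, s⟩ ⟨B, s.trans f.toEmbedding⟩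

theorem IsTypeEmb.refl (A : Type) [L.Structure A] : IsTypeEmb F (.refl L A) :=
  fun _ _ => Nerode.refl _

theorem IsTypeEmb.comp {A B C : Type} [L.Structure A] [L.Structure B] [L.Structure C]
    {g : B ↪[L] C} {f : A ↪[L] B} (hg : IsTypeEmb F g) (hf : IsTypeEmb F f) :
    IsTypeEmb F (g.comp f) :=
  fun n s => (hf n s).trans (hg n _)

variable (F) in
/-- Countable structures that are not bad, with vertices coded by pairs of natural numbers. -/
structure Stage where
  carrier : Type
  [str : L.Structure carrier]
  code : carrier ↪ ℕ × ℕ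
  bound : ℕ
  lt_bound : ∀ x, (code x).1 < bound
  not_bad : ¬ Bad F carrier

attribute [instance] Stage.str

/-- Embeddings must preserve the codes and are therefore unique, so chains of stages commute
automatically and the limit can be formed on a set of codes. -/
instance : Preorder (Stage F) where
  le p q := ∃ f : p.carrier ↪[L] q.carrier, (∀ x, q.code (f x) = p.code x) ∧ IsTypeEmb F f
  le_refl p := ⟨.refl L _, fun _ => rfl, .refl _⟩
  le_trans _ _ _ := fun ⟨f, hf, hf'⟩ ⟨g, hg, hg'⟩ =>
    ⟨g.comp f, fun x => (hg _).trans (hf x), hg'.comp hf'⟩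

instance (p : Stage F) : Countable p.carrier := p.code.injective.countable

variable [L.IsRelational]

/-- Extending a stage by a prescribed type over a tuple. -/
theorem Stage.exists_extension (p : Stage F) (s : Fin n ↪ p.carrier) (P : Rooted L (n + 1))
    [Countable P.carrier] (h : Nerode F (P.reroot Fin.castSuccEmb) ⟨p.carrier, s⟩) :
    ∃ (q : Stage F) (_ : p ≤ q) (s' : Fin (n + 1) ↪ q.carrier),
      (∀ i, q.code (s' (Fin.castSucc i)) = p.code (s i)) ∧ Nerode F P ⟨q.carrier, s'⟩ := by
  classical
  obtain ⟨A, g, f, hA⟩ := exists_amalgam h.sameRoots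
  have := hA.countable
  obtain ⟨enc, henc⟩ := Countable.exists_injective_nat A
  -- New vertices get the first coordinate `p.bound`, unused in `p`, so old codes are kept and no
  -- collision arises.
  have hex : ∀ y : A, ∃ c : ℕ × ℕ, (∀ x, f x = y → p.code x = c) ∧
      ((∀ x, f x ≠ y) → c = (p.bound, enc y)) ∧ c.1 < p.bound + 1 := by
    intro y
    by_cases hy : ∃ x, f x = y
    · obtain ⟨x, rfl⟩ := hy
      exact ⟨p.code x, fun x' e => by rw [f.injective e], fun h => (h x rfl).elim,
        (p.lt_bound x).trans (Nat.lt_succ_self _)⟩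
    · exact ⟨_, fun x e => (hy ⟨x, e⟩).elim, fun _ => rfl, Nat.lt_succ_self _⟩
  choose c hc₁ hc₂ hc₃ using hex
  have hcf : ∀ x, c (f x) = p.code x := fun x => (hc₁ _ x rfl).symm
  have hcinj : Function.Injective c := by
    intro y y' e
    by_cases hy : ∃ x, f x = y
    · obtain ⟨x, rfl⟩ := hy
      by_cases hy' : ∃ x, f x = y'
      · obtain ⟨x', rfl⟩ := hy'
        rw [hcf, hcf] at e
        rw [p.code.injective e]
      · rw [hcf, hc₂ y' (not_exists.1 hy')] at e
        exact absurd (p.lt_bound x) (by rw [e]; exact lt_irrefl _)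
    · by_cases hy' : ∃ x, f x = y'
      · obtain ⟨x', rfl⟩ := hy'
        rw [hcf, hc₂ y (not_exists.1 hy)] at e
        exact absurd (p.lt_bound x') (by rw [← e]; exact lt_irrefl _)
      · rw [hc₂ y (not_exists.1 hy), hc₂ y' (not_exists.1 hy')] at e
        exact henc (Prod.mk.inj e).2
  refine ⟨⟨A, ⟨c, hcinj⟩, p.bound + 1, hc₃, h.not_bad_amalgam p.not_bad hA⟩,
    ⟨f, hcf, fun m t => h.symm.amalgam_left hA.symm t⟩, P.root.trans g.toEmbedding, fun i => ?_,
    h.amalgam_left hA P.root⟩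
  exact (congrArg c (hA.root_eq i)).trans (hcf (s i))

theorem exists_stage (hF : IsAdmissible F) : Nonempty (Stage F) := by
  let _ : L.Structure Empty := ⟨fun f => isEmptyElim f, fun _ _ => False⟩
  refine ⟨⟨Empty, ⟨fun x => x.elim, fun x => x.elim⟩, 0, fun x => x.elim, ?_⟩⟩
  rintro ⟨G, hG, h, -⟩
  obtain ⟨x⟩ := (isConn_iff.1 (hF.conn G hG)).1
  exact (h x).elim

/-- A countable structure in `Forb(F)` realizing all types over its tuples. -/
theorem exists_generic (hF : IsAdmissible F)
    (hfin : ∀ n, Finite (Quotient (nerodeSetoid F n))) :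
    ∃ U : Bundled.{0} L.Structure, Countable U ∧ ¬ Bad F U ∧
      ∀ (n : ℕ) (s : Fin n ↪ U) (P : Rooted L (n + 1)), Countable P.carrier →
        Nerode F (P.reroot Fin.castSuccEmb) ⟨U, s⟩ →
        ∃ s' : Fin (n + 1) ↪ U, (∀ i, s' (Fin.castSucc i) = s i) ∧ Nerode F P ⟨U, s'⟩ := by
  classical
  -- A task is a tuple, given by its codes, and a class to be realized over it. Finite index makes
  -- the set of tasks countable.
  let Task := Σ n : ℕ, (Fin n → ℕ × ℕ) × Quotient (nerodeSetoid F (n + 1))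
  let _ : Encodable Task := Encodable.ofCountable _
  let good : Task → Stage F → Prop := fun a p => ∀ s : Fin a.1 ↪ p.carrier,
    (∀ i, p.code (s i) = a.2.1 i) → (∃ P : Rooted L (a.1 + 1), Countable P.carrier ∧
      nerodeClass F P = a.2.2 ∧ Nerode F (P.reroot Fin.castSuccEmb) ⟨p.carrier, s⟩) →
    ∃ s' : Fin (a.1 + 1) ↪ p.carrier, (∀ i, s' (Fin.castSucc i) = s i) ∧
      nerodeClass F ⟨p.carrier, s'⟩ = a.2.2
  have hgood : ∀ a p, ∃ q, good a q ∧ p ≤ q := by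
    intro a p
    by_cases hp : good a p
    · exact ⟨p, hp, le_rfl⟩
    simp only [good, not_forall] at hp
    obtain ⟨s, hs, ⟨P, hPc, hPa, hP⟩, -⟩ := hp
    obtain ⟨q, hpq, s', hs', hq⟩ := p.exists_extension s P hP
    refine ⟨q, fun t ht _ => ⟨s', fun i => q.code.injective ?_, ?_⟩, hpq⟩
    · rw [hs', hs, ht]
    · rw [← hPa]
      exact nerodeClass_eq.2 hq.symm
  -- The factor `ℕ` makes every task recur arbitrarily late, after its tuple has appeared.
  let 𝒟 : Task × ℕ → Order.Cofinal (Stage F) := fun a => ⟨{p | good a.1 p}, fun p => hgood a.1 p⟩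
  obtain ⟨p₀⟩ := exists_stage hF
  let S : ℕ → Stage F := Order.sequenceOfCofinals p₀ 𝒟
  have hmono : Monotone S := Order.sequenceOfCofinals.monotone p₀ 𝒟
  have hmem : ∀ a k, ∃ j, k ≤ j ∧ good a (S j) := fun a k =>
    ⟨_, (Nat.right_le_pair _ _).trans (Nat.le_succ _),
      Order.sequenceOfCofinals.encode_mem p₀ 𝒟 (a, k)⟩
  choose e he het using fun {i j} (h : i ≤ j) => hmono h
  let U := {v : ℕ × ℕ // ∃ k, v ∈ Set.range (S k).code}
  let _ : L.Structure U := ⟨fun f => isEmptyElim f,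
    fun r t => ∃ k s, RelMap r s ∧ ∀ i, (S k).code (s i) = (t i).1⟩
  let ι : ∀ k, (S k).carrier ↪[L] U := fun k =>
    mkEmb (fun x => ⟨(S k).code x, k, x, rfl⟩)
      (fun x y h => (S k).code.injective (congrArg Subtype.val h)) (by
        intro a r t
        refine ⟨fun ⟨j, s, hs, hst⟩ => ?_, fun ht => ⟨k, t, ht, fun _ => rfl⟩⟩
        rw [← (e (le_max_left k j)).map_rel]
        rw [← (e (le_max_right k j)).map_rel] at hs
        convert hs using 1
        refine funext fun i => (S _).code.injective ?_
        simp only [Function.comp_apply, he, hst])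
  have hι : ∀ {i j} (h : i ≤ j) (x), ι j (e h x) = ι i x := fun h x => Subtype.ext (he h x)
  have hιc : ∀ k x, (ι k x).1 = (S k).code x := fun _ _ => rfl
  have hcov : ∀ W : Set U, W.Finite → ∀ k, ∃ j, k ≤ j ∧ ∀ x ∈ W, ∃ y, ι j y = x := by
    intro W hW k
    induction W, hW using Set.Finite.induction_on with
    | empty => exact ⟨k, le_rfl, fun x hx => hx.elim⟩
    | @insert x W _ _ ih =>
      obtain ⟨j, hj, hjW⟩ := ih
      obtain ⟨l, y, hy⟩ := x.2
      refine ⟨max j l, hj.trans (le_max_left _ _), ?_⟩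
      rintro z (rfl | hz)
      · exact ⟨e (le_max_right _ _) y, (hι _ _).trans (Subtype.ext hy)⟩
      · obtain ⟨w, hw⟩ := hjW z hz
        exact ⟨e (le_max_left _ _) w, (hι _ _).trans hw⟩
  have hιt : ∀ k, IsTypeEmb F (ι k) := by
    intro k n s
    have hs : SameRoots (⟨(S k).carrier, s⟩ : Rooted L n) ⟨U, s.trans (ι k).toEmbedding⟩ :=
      SameRoots.of_embeddings (P := ⟨(S k).carrier, s⟩) (Q := ⟨U, s.trans (ι k).toEmbedding⟩) (ι k)
        (.refl L U) fun _ => rfl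
    refine .of_imp hs (fun R hR => hR.map (hs.symm.trans hR.sameRoots) fun A a b hA =>
      ⟨a ∘ ι k, b, (homEmb_embedding a).comp (homEmb_embedding (ι k)), homEmb_embedding b,
        hA.root_eq⟩) fun R hR => ?_
    -- A clash with the limit needs only finitely many of its vertices and so already occurs at a
    -- later stage `j`, to which stage `k` maps preserving classes.
    obtain ⟨W, hW, hWS⟩ := hR.exists_sub hF
    obtain ⟨j, hkj, hj⟩ := hcov W hW k
    have hr : ∀ i, (s.trans (ι k).toEmbedding) i ∈ Set.range (ι j) :=
      fun i => ⟨e hkj (s i), hι _ _⟩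
    have hc := hWS (Set.range (ι j)) hr hj
    obtain ⟨f, hf⟩ := exists_embedding_factor (indEmb L (Set.range (ι j))) (ι j) fun x => x.2
    have ht := het hkj n s
    refine (ht.clash_iff R).2 (hc.map (ht.sameRoots.symm.trans (hs.trans hR.sameRoots))
      fun A a b hA => ⟨a ∘ f, b, (homEmb_embedding a).comp (homEmb_embedding f),
        homEmb_embedding b, fun i => ?_⟩)
    refine Eq.trans (congrArg a ((ι j).injective ?_)) (hA.root_eq i)
    exact (hf _).trans (hι _ _).symm
  have hUc : Countable U := Subtype.countable
  refine ⟨⟨U, inferInstance⟩, hUc, fun hbad => ?_, fun n s P hPc hP => ?_⟩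
  · obtain ⟨W, hW, hWF⟩ := hF.exists_ind_mem hbad
    obtain ⟨j, -, hj⟩ := hcov W hW 0
    obtain ⟨f, -⟩ := exists_embedding_factor (indEmb L W) (ι j) fun x => hj x.1 x.2
    exact (S j).not_bad ⟨_, hWF, f, homEmb_embedding f⟩
  · obtain ⟨k, -, hk⟩ := hcov (Set.range s) (Set.finite_range s) 0
    let a : Task := ⟨n, fun i => (s i).1, nerodeClass F P⟩
    obtain ⟨j, hkj, hj⟩ := hmem a k
    choose t₀ ht₀ using fun i => hk (s i) ⟨i, rfl⟩
    let t : Fin n ↪ (S j).carrier := ⟨fun i => e hkj (t₀ i), fun i i' h => by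
      have := (e hkj).injective h
      exact s.injective (by rw [← ht₀, ← ht₀, this])⟩
    have ht : ∀ i, ι j (t i) = s i := fun i => (hι _ _).trans (ht₀ i)
    have hst : t.trans (ι j).toEmbedding = s := Function.Embedding.ext ht
    have hP' := hιt j n t
    rw [hst] at hP'
    obtain ⟨s', hs', hc⟩ := hj t (fun i => congrArg Subtype.val (ht i))
      ⟨P, hPc, rfl, hP.trans hP'.symm⟩
    exact ⟨s'.trans (ι j).toEmbedding, fun i => (congrArg (ι j) (hs' i)).trans (ht i),
      (nerodeClass_eq.1 hc).symm.trans (hιt j _ s')⟩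

end Generic

/-! ### The ultrahomogeneous lift by class predicates -/

section Lift

variable {L : FirstOrder.Language.{u, v}} {F : Set (Bundled.{0} L.Structure)} {n m : ℕ}

/-- Relation symbols of the lifted language: `c n` symbols of arity `n + 1`. -/
def typeSymbols (c : ℕ → ℕ) : ℕ → Type
  | 0 => Empty
  | n + 1 => Fin (c n)

/-- The language of type predicates. -/
def typeLanguage (c : ℕ → ℕ) : FirstOrder.Language.{0, 0} := ⟨fun _ => Empty, typeSymbols c⟩

instance (c : ℕ → ℕ) : (typeLanguage c).IsRelational := fun _ => inferInstanceAs (IsEmpty Empty)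

instance (c : ℕ → ℕ) : IsEmpty ((typeLanguage c).Relations 0) := inferInstanceAs (IsEmpty Empty)

theorem finite_typeLanguage (c : ℕ → ℕ) (n : ℕ) : Finite ((typeLanguage c).Relations n) := by
  cases n with
  | zero => exact inferInstanceAs (Finite Empty)
  | succ n => exact inferInstanceAs (Finite (Fin (c n)))

/-- The interpretation of the type predicates given by a colouring of rooted structures. -/
def typeRel {c : ℕ → ℕ} (col : ∀ n, Rooted L (n + 1) → Fin (c n)) (A : Type) [L.Structure A] :
    ∀ {n : ℕ}, (typeLanguage c).Relations n → (Fin n → A) → Prop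
  | 0, _, _ => False
  | n + 1, r, t => ∃ h : Function.Injective t, col n ⟨A, ⟨t, h⟩⟩ = r

/-- The lift of a structure by the type predicates. -/
def lift {c : ℕ → ℕ} (col : ∀ n, Rooted L (n + 1) → Fin (c n)) (A : Bundled.{0} L.Structure) :
    Bundled.{0} (L.sum (typeLanguage c)).Structure :=
  ⟨A, { funMap := fun f => f.elim (fun f => funMap f) fun f => Empty.elim f
        RelMap := fun r => r.elim (fun r => RelMap r) fun r => typeRel col A r }⟩

variable {c : ℕ → ℕ} {col : ∀ n, Rooted L (n + 1) → Fin (c n)}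

theorem typeRel_injective {A : Type} [L.Structure A] (r : (typeLanguage c).Relations n)
    (t : Fin n → A) (h : typeRel col A r t) : Function.Injective t := by
  cases n with
  | zero => exact Function.injective_of_subsingleton t
  | succ n => exact h.1

variable [L.IsRelational]

/-- Class predicates of subtuples are determined by the class of the whole tuple, by
`Nerode.reroot`. -/
theorem lift_relMap_iff (hcol : ∀ n P Q, col n P = col n Q ↔ Nerode F P Q)
    {A B : Bundled.{0} L.Structure} {s : Fin n ↪ A} {s' : Fin n ↪ B}
    (h : Nerode F ⟨A, s⟩ ⟨B, s'⟩) {k : ℕ} (r : (L.sum (typeLanguage c)).Relations k)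
    (τ : Fin k → Fin n) : RelMap (M := lift col A) r (s ∘ τ) ↔ RelMap (M := lift col B) r (s' ∘ τ) := by
  cases r with
  | inl r => exact h.sameRoots k r τ
  | inr r =>
    cases k with
    | zero => exact Iff.rfl
    | succ k =>
      have key : ∀ hτ : Function.Injective τ,
          col k ⟨A, ⟨s ∘ τ, s.injective.comp hτ⟩⟩ = col k ⟨B, ⟨s' ∘ τ, s'.injective.comp hτ⟩⟩ :=
        fun hτ => (hcol _ _ _).2 (h.reroot ⟨τ, hτ⟩)
      constructor
      · rintro ⟨hi, e⟩
        exact ⟨s'.injective.comp (Function.Injective.of_comp hi),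
          (key (Function.Injective.of_comp hi)).symm.trans e⟩
      · rintro ⟨hi, e⟩
        exact ⟨s.injective.comp (Function.Injective.of_comp hi),
          (key (Function.Injective.of_comp hi)).trans e⟩

/-- The predicate naming the class of `s` holds at `s'`. The empty tuple carries no predicate, but
there all structures that are not bad are equivalent. -/
theorem nerode_of_lift_embedding (hF : IsAdmissible F) (hL : IsEmpty (L.Relations 0))
    (hcol : ∀ n P Q, col n P = col n Q ↔ Nerode F P Q) {A U : Bundled.{0} L.Structure}
    (hA : ¬ Bad F A) (hU : ¬ Bad F U) (s : Fin n ↪ A) (s' : Fin n ↪ U)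
    (h : ∀ r : (L.sum (typeLanguage c)).Relations n,
      RelMap (M := lift col A) r s → RelMap (M := lift col U) r s') :
    Nerode F ⟨A, s⟩ ⟨U, s'⟩ := by
  cases n with
  | zero => exact nerode_of_width_zero hF hL hA hU
  | succ n =>
    obtain ⟨hi, e⟩ := h (Sum.inr (col n ⟨A, s⟩)) ⟨s.injective, rfl⟩
    exact ((hcol _ _ _).1 e).symm

/-- Lifts of structures in `Forb(F)` can be mapped into the lift of a generic structure by forth. -/
theorem isExtensionPair_lift (hF : IsAdmissible F) (hL : IsEmpty (L.Relations 0))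
    (hcol : ∀ n P Q, col n P = col n Q ↔ Nerode F P Q) {A U : Bundled.{0} L.Structure}
    [Countable A] (hA : ¬ Bad F A) (hU : ¬ Bad F U)
    (hgen : ∀ (n : ℕ) (s : Fin n ↪ U) (P : Rooted L (n + 1)), Countable P.carrier →
        Nerode F (P.reroot Fin.castSuccEmb) ⟨U, s⟩ →
        ∃ s' : Fin (n + 1) ↪ U, (∀ i, s' (Fin.castSucc i) = s i) ∧ Nerode F P ⟨U, s'⟩) :
    (L.sum (typeLanguage c)).IsExtensionPair (lift col A) (lift col U) := by
  rw [isExtensionPair_iff_exists_embedding_closure_singleton_sup]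
  intro S hS f m
  by_cases hm : m ∈ S
  · refine ⟨f.comp (Substructure.inclusion (sup_le
      ((Substructure.closure_le).2 (Set.singleton_subset_iff.2 hm)) le_rfl)), ?_⟩
    ext x
    rfl
  have hSf : Finite S := hS.finite
  obtain ⟨n, ⟨b⟩⟩ := Finite.exists_equiv_fin S
  let s : Fin n ↪ A := b.symm.toEmbedding.trans (Function.Embedding.subtype _)
  let s₁ : Fin n ↪ U := b.symm.toEmbedding.trans f.toEmbedding
  have h₁ : Nerode F ⟨A, s⟩ ⟨U, s₁⟩ := nerode_of_lift_embedding hF hL hcol hA hU s s₁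
    fun r hr => (f.map_rel r b.symm).2 hr
  have hs : ∀ x : S, s (b x) = x.1 := fun x => congrArg Subtype.val (b.symm_apply_apply x)
  have hs' : ∀ i, s i ∈ S := fun i => (b.symm i).2
  let t : Fin (n + 1) ↪ A := ⟨Fin.snoc (α := fun _ => A) s m,
    Fin.snoc_injective_iff.2 ⟨s.injective, fun ⟨i, hi⟩ => hm (hi ▸ hs' i)⟩⟩
  have ht : ∀ i, t (Fin.castSucc i) = s i := fun i => Fin.snoc_castSucc (α := fun _ => A) _ _ i
  have htm : t (Fin.last n) = m := Fin.snoc_last (α := fun _ => A) _ _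
  have hts : Fin.castSuccEmb.trans t = s := Function.Embedding.ext ht
  -- The whole of `A`, rooted at the domain of `f` and the new vertex, serves as the one-point
  -- extension to be realized.
  obtain ⟨t', ht', hN⟩ := hgen n s₁ ⟨A, t⟩ inferInstance (by
    rw [← hts] at h₁
    exact h₁)
  have hmem : ∀ x : (Substructure.closure (L.sum (typeLanguage c)) {m} ⊔ S :
      (L.sum (typeLanguage c)).Substructure (lift col A)), ∃ i, t i = x.1 := by
    rintro ⟨x, hx⟩
    rw [← Substructure.closure_eq S, ← Substructure.closure_union,
      Substructure.mem_closure_iff_of_isRelational] at hx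
    rcases hx with hx | hx
    · exact ⟨Fin.last n, htm.trans hx.symm⟩
    · exact ⟨Fin.castSucc (b ⟨x, hx⟩), (ht _).trans (hs ⟨x, hx⟩)⟩
  choose idx hidx using hmem
  refine ⟨mkEmb (fun x => t' (idx x)) (fun x y e => Subtype.ext ?_) fun r w => ?_, ?_⟩
  · rw [← hidx x, ← hidx y, t'.injective e]
  · refine (lift_relMap_iff hcol hN r (idx ∘ w)).symm.trans ?_
    exact iff_of_eq (congrArg (RelMap (M := lift col A) r) (funext fun i => hidx (w i)))
  · ext x
    have : idx (Substructure.inclusion le_sup_right x) = Fin.castSucc (b x) := by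
      refine t.injective ((hidx _).trans ?_)
      rw [ht]
      exact (hs x).symm
    change f x = t' (idx (Substructure.inclusion le_sup_right x))
    rw [this, ht']
    exact congrArg f (b.symm_apply_apply x).symm

/-- The forth property from `U` to itself gives ultrahomogeneity; from a member of `Forb(F)` to `U`
it gives universality. -/
theorem IsRegular.exists_ultrahomogeneous_lift [Finite (Σ n, L.Relations n)]
    (hL : IsEmpty (L.Relations 0)) (hF : IsAdmissible F) (hreg : IsRegular F) :
    ∃ (L' : FirstOrder.Language.{0, 0}) (U : Bundled.{0} (L.sum L').Structure),
      L'.IsRelational ∧ IsEmpty (L'.Relations 0) ∧ (∀ n, Finite (L'.Relations n)) ∧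
      (∀ (n : ℕ) (r : L'.Relations n) (t : Fin n → U),
        RelMap (L := L.sum L') (Sum.inr r) t → Function.Injective t) ∧
      (L.sum L').IsUltrahomogeneous U ∧ shadow U ∈ Forb F ∧
      IsUniversalFor (shadow U) (Forb F) := by
  have hfin := hreg.finite_nerode hF
  obtain ⟨U, hUc, hU, hgen⟩ := exists_generic hF hfin
  let c : ℕ → ℕ := fun n => Nat.card (Quotient (nerodeSetoid F (n + 1)))
  let col : ∀ n, Rooted L (n + 1) → Fin (c n) := fun n P =>
    Finite.equivFin (Quotient (nerodeSetoid F (n + 1))) (nerodeClass F P)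
  have hcol : ∀ n P Q, col n P = col n Q ↔ Nerode F P Q := fun n P Q =>
    (Finite.equivFin _).injective.eq_iff.trans nerodeClass_eq
  have hUc' : Countable (lift col U) := hUc
  refine ⟨typeLanguage c, lift col U, inferInstance, inferInstance, finite_typeLanguage c,
    fun n r t h => typeRel_injective (A := U) (col := col) r t h, ?_, ?_, fun A hA => ?_⟩
  · exact (isUltrahomogeneous_iff_IsExtensionPair Structure.cg_of_countable).2
      (isExtensionPair_lift hF hL hcol hU hU hgen)
  · refine (mem_forb_iff _).2 ⟨hUc, fun h => hU ?_⟩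
    let e : shadow (lift col U) ↪[L] U := mkEmb id Function.injective_id fun r t => Iff.rfl
    exact h.map (homEmb_embedding e)
  · obtain ⟨hAc, hAb⟩ := (mem_forb_iff _).1 hA
    have hAc' : Countable (lift col A) := hAc
    have : IsEmpty ((L.sum (typeLanguage c)).Relations 0) :=
      inferInstanceAs (IsEmpty (L.Relations 0 ⊕ (typeLanguage c).Relations 0))
    -- The map is built from `default`, the empty partial isomorphism, available because there are
    -- no nullary relations.
    obtain ⟨f, -⟩ := embedding_from_cg (M := lift col A) (N := lift col U)
      Structure.cg_of_countable default (isExtensionPair_lift hF hL hcol hAb hU hgen)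
    exact ⟨mkEmb f f.injective fun r t => f.map_rel (Sum.inl r) t⟩

end Lift

/-! ### Orbits: from the lift to ω-categoricity and back to regularity -/

section Categoricity

variable {L : FirstOrder.Language.{u, v}} {n : ℕ}

/-- Although `L'` may have infinitely many symbols, those of arity above `n` never hold on vertices
of an `n`-tuple. The finite datum `d` thus fixes the quantifier-free type, hence the orbit under
automorphisms of `U`, which are automorphisms of the shadow. -/
theorem isOmegaCategorical_shadow [L.IsRelational] [Finite (Σ n, L.Relations n)]
    {L' : FirstOrder.Language.{0, 0}} [L'.IsRelational] {U : Bundled.{0} (L.sum L').Structure}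
    (hfin : ∀ n, Finite (L'.Relations n))
    (hinj : ∀ (n : ℕ) (r : L'.Relations n) (t : Fin n → U),
      RelMap (L := L.sum L') (Sum.inr r) t → Function.Injective t)
    (hU : (L.sum L').IsUltrahomogeneous U) : IsOmegaCategorical L (shadow U) := by
  intro n
  let d := fun x : Fin n → U => (({p | x p.1 = x p.2} : Set (Fin n × Fin n)),
    ({p | RelMap (L := L.sum L') (Sum.inl p.1.2) (x ∘ p.2)} :
      Set (Σ k : (Σ k, L.Relations k), Fin k.1 → Fin n)),
    ({p | RelMap (L := L.sum L') (Sum.inr p.2.1) (x ∘ p.2.2)} :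
      Set (Σ k : Fin (n + 1), L'.Relations k × (Fin k → Fin n))))
  have key : ∀ x y : Fin n → U, d x = d y → (orbitSetoid L (shadow U) n).r x y := by
    intro x y hxy
    simp only [d, Prod.mk.injEq] at hxy
    obtain ⟨h₀, h₁, h₂⟩ := hxy
    have heq : ∀ i j, x i = x j ↔ y i = y j := fun i j => Set.ext_iff.1 h₀ (i, j)
    have hle : ∀ {k} (r : L'.Relations k) (z : Fin n → U) (τ : Fin k → Fin n),
        RelMap (L := L.sum L') (Sum.inr r) (z ∘ τ) → k < n + 1 := fun {k} r z τ h => by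
      have := Fintype.card_le_of_injective τ (Function.Injective.of_comp (hinj _ _ _ h))
      simp only [Fintype.card_fin] at this
      exact Nat.lt_succ_of_le this
    have hrel : ∀ {k} (r : (L.sum L').Relations k) (τ : Fin k → Fin n),
        RelMap r (y ∘ τ) ↔ RelMap r (x ∘ τ) := by
      intro k r τ
      cases r with
      | inl r => exact (Set.ext_iff.1 h₁ ⟨⟨k, r⟩, τ⟩).symm
      | inr r =>
        have h3 : ∀ hk : k < n + 1, RelMap (L := L.sum L') (Sum.inr r) (x ∘ τ) ↔
            RelMap (L := L.sum L') (Sum.inr r) (y ∘ τ) :=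
          fun hk => Set.ext_iff.1 h₂ ⟨⟨k, hk⟩, r, τ⟩
        exact ⟨fun h => (h3 (hle r y τ h)).2 h, fun h => (h3 (hle r x τ h)).1 h⟩
    choose idx hidx using fun a : ind (L.sum L') (Set.range x) => a.2
    let f : ind (L.sum L') (Set.range x) ↪[L.sum L'] U := mkEmb (fun a => y (idx a))
      (fun a b e => Subtype.ext (by rw [← hidx a, ← hidx b, (heq _ _).2 e])) fun r t =>
        (hrel r (idx ∘ t)).trans (iff_of_eq (congrArg (RelMap r) (funext fun i => hidx (t i))))
    have hfg : (ind (L.sum L') (Set.range x)).FG :=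
      Substructure.fg_iff_finite.2 (Set.finite_range x)
    obtain ⟨g, hg⟩ := hU _ hfg f
    refine ⟨⟨g.toEquiv, fun f => isEmptyElim f, fun r t => g.map_rel (Sum.inl r) t⟩, fun i => ?_⟩
    have h3 : f ⟨x i, i, rfl⟩ = g (x i) := by rw [hg]; rfl
    exact h3.symm.trans ((heq _ _).1 (hidx ⟨x i, i, rfl⟩))
  refine Finite.of_injective (fun q : Quotient (orbitSetoid L (shadow U) n) => d q.out)
    fun q q' e => ?_
  rw [← Quotient.out_eq q, ← Quotient.out_eq q']
  exact Quotient.sound (key _ _ e)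

/-- The component is connected and every root has a neighbour in it. -/
theorem IsPiece.isConn {P : Rooted L n} {G : Type} [L.Structure G] (h : IsPiece P G) :
    IsConn L P.carrier := by
  obtain ⟨R, C, C₂, e, ⟨hC, -, -, hn, -⟩, hr, -⟩ := h
  rw [isComponent_iff] at hC
  have hlift : ∀ {k} (r : L.Relations k) (t : Fin k → G), RelMap r t → ∀ i, t i ∈ C →
      ∃ s, RelMap r s ∧ e ∘ s = t := by
    intro k r t ht i hi
    have hm : ∀ j, t j ∈ Set.range e := fun j => by
      rw [hr]
      exact hC.closedOff k r t ht i j hi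
    choose s hs using hm
    obtain rfl : e ∘ s = t := funext hs
    exact ⟨s, (e.map_rel r s).1 ht, rfl⟩
  rw [isConn_iff]
  refine ⟨?_, fun K ⟨x, hx⟩ hK => ?_⟩
  · obtain ⟨y, hy⟩ := hC.nonempty
    have hyr : y ∈ Set.range e := by rw [hr]; exact Or.inl hy
    exact ⟨hyr.choose⟩
  · have hne : ({z ∈ C | ∃ p ∈ K, e p = z}).Nonempty := by
      have hxr : e x ∈ C ∪ R := by rw [← hr]; exact ⟨x, rfl⟩
      rcases hxr with h | h
      · exact ⟨e x, h, x, hx, rfl⟩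
      · rw [← hn] at h
        obtain ⟨-, y, hy, -, k, r, t, ht, ⟨i, hi⟩, ⟨j, rfl⟩⟩ := h
        obtain ⟨s, hs, rfl⟩ := hlift r t ht j hy
        obtain rfl := e.injective hi
        exact ⟨_, hy, s j, hK k r s hs i j hx, rfl⟩
    have hCK := hC.minimal _ (Set.sep_subset _ _) hne (by
      rintro k r t ht i j ⟨hi, p, hp, hpi⟩
      obtain ⟨s, hs, rfl⟩ := hlift r t ht i hi
      obtain rfl := e.injective hpi
      exact (hC.closedOff k r _ ht i j hi).imp (fun h => ⟨h, s j, hK k r s hs i j hp, rfl⟩) id)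
    have hCK' : ∀ p, e p ∈ C → p ∈ K := fun p hp => by
      rw [← hCK] at hp
      obtain ⟨-, q, hq, e'⟩ := hp
      rwa [← e.injective e']
    refine Set.eq_univ_of_forall fun p => ?_
    have hpr : e p ∈ C ∪ R := by rw [← hr]; exact ⟨p, rfl⟩
    rcases hpr with h | h
    · exact hCK' p h
    · rw [← hn] at h
      obtain ⟨-, y, hy, -, k, r, t, ht, ⟨i, hi⟩, ⟨j, rfl⟩⟩ := h
      obtain ⟨s, hs, rfl⟩ := hlift r t ht j hy
      obtain rfl := e.injective hi
      exact hK k r s hs j i (hCK' _ hy)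

/-- Replacing one side of a connected free amalgam by a connected structure. -/
theorem IsFreeAmalgam.isConn_of_swap (hn : 1 ≤ n) {P P' Q : Rooted L n} {G A : Type} [L.Structure G]
    [L.Structure A] {f : P.carrier ↪[L] G} {g : Q.carrier ↪[L] G} {f' : P'.carrier ↪[L] A}
    {g' : Q.carrier ↪[L] A} (hG : IsFreeAmalgam P Q f g) (hA : IsFreeAmalgam P' Q f' g')
    (hGc : IsConn L G) (hP' : IsConn L P'.carrier) : IsConn L A := by
  rw [isConn_iff] at hGc hP' ⊢
  have key : ∀ K : Set A, K.Nonempty → (∀ (k : ℕ) (r : L.Relations k) (t : Fin k → A), RelMap r t →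
      ∀ i j, t i ∈ K → t j ∈ K) → ∀ p, f' p ∈ K := by
    intro K ⟨x, hx⟩ hK
    by_cases hne : ∃ p, f' p ∈ K
    · have := hP'.2 (f' ⁻¹' K) hne fun k r t ht i j =>
        hK k r (f' ∘ t) ((f'.map_rel r t).2 ht) i j
      exact fun p => (Set.ext_iff.1 this p).2 trivial
    · exfalso
      obtain ⟨q, rfl⟩ := (hA.mem_or x).resolve_left fun ⟨p, hp⟩ => hne ⟨p, hp ▸ hx⟩
      have hroot : ∀ p q, f p = g q → g' q ∉ K := by
        intro p q e hq
        obtain ⟨i, rfl, rfl⟩ := hG.eq_root e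
        rw [← hA.root_eq] at hq
        exact hne ⟨_, hq⟩
      have := hGc.2 {y | ∃ q, g' q ∈ K ∧ g q = y} ⟨g q, q, hx, rfl⟩ (by
        rintro k r t ht i j ⟨q, hq, hqi⟩
        rcases hG.free k r t ht with h | h
        · obtain ⟨p, hp⟩ := h i
          exact (hroot p q (hp.trans hqi.symm) hq).elim
        · choose s hs using h
          obtain rfl : g ∘ s = t := funext hs
          obtain rfl := g.injective hqi
          exact ⟨s j, hK k r (g' ∘ s) ((g'.map_rel r s).2 ((g.map_rel r s).1 ht)) i j hq, rfl⟩)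
      obtain ⟨q', hq', e⟩ := (Set.ext_iff.1 this (f (P.root ⟨0, hn⟩))).2 trivial
      exact hroot _ _ e.symm hq'
  refine ⟨hP'.1.map f', fun K hne hK => Set.eq_univ_of_forall fun y => ?_⟩
  by_contra hy
  -- The complement of a closed set is closed, so `K` and `Kᶜ` would both contain the root `0`,
  -- which exists since `1 ≤ n`.
  exact key Kᶜ ⟨y, hy⟩ (fun k r t ht i j hi hj => hi (hK k r t ht j i hj)) (P'.root ⟨0, hn⟩)
    (key K hne hK _)

variable [L.IsRelational] {F : Set (Bundled.{0} L.Structure)}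

/-- Suppose `p ⊕ Q ∈ F` while `p' ⊕ Q` is not in `F`. The latter is finite and connected, so by
upward closure it lies in `Forb(F)` and embeds into `U`. If `p` reaches the same root orbits as
`p'`, an automorphism moves a map of `p` onto the same roots, and `p ⊕ Q` maps into `U`, a
contradiction. -/
theorem isRegular_of_universal [Finite (Σ n, L.Relations n)] (hF : IsAdmissible F)
    {U : Bundled.{0} L.Structure} (hU : U ∈ Forb F) (huniv : IsUniversalFor U (Forb F))
    (hcat : IsOmegaCategorical L U) : IsRegular F := by
  intro n hn
  have := hcat n
  have hUb := ((mem_forb_iff U).1 hU).2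
  let d := fun p : Piece F n => (rootDiagram p.1, ({o | ∃ h : p.1.carrier → U, HomEmb L h ∧
    Quotient.mk _ (h ∘ p.1.root) = o} : Set (Quotient (orbitSetoid L U n))))
  have hfinite : ∀ p : Piece F n, Finite p.1.carrier := by
    rintro ⟨P, G, hG, R, C₁, C₂, e, -⟩
    have := hF.finite G hG
    exact Finite.of_injective e e.injective
  have key : ∀ p p' : Piece F n, d p = d p' → incompatible F p.1 ⊆ incompatible F p'.1 := by
    rintro p p' hd Q ⟨G, hG, f, g, hGa⟩
    simp only [d, Prod.mk.injEq] at hd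
    have hsr : SameRoots p.1 p'.1 := .of_rootDiagram hd.1
    obtain ⟨A, f', g', hA⟩ := exists_amalgam (hsr.symm.trans hGa.sameRoots)
    obtain ⟨G', hG', hpiece⟩ := p'.2
    have hconn := hGa.isConn_of_swap hn hA (hF.conn G hG) hpiece.isConn
    have := hF.finite G hG
    have hQf : Finite Q.carrier := Finite.of_injective g g.injective
    have := hfinite p'
    have hAf : Finite A := by
      rw [← Set.finite_univ_iff, ← hA.cover]
      exact (Set.finite_range f').union (Set.finite_range g')
    refine ⟨A, ?_, f', g', hA⟩
    by_contra hAF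
    obtain ⟨u⟩ := huniv A ((mem_forb_iff A).2 ⟨inferInstance, fun ⟨H, hH, h, hh⟩ =>
      hAF (hF.mem_of_homEmb hH hconn hh)⟩)
    obtain ⟨h, hh, ho⟩ := (Set.ext_iff.1 hd.2 (Quotient.mk _ ((u ∘ f') ∘ p'.1.root))).2
      ⟨u ∘ f', (homEmb_embedding u).comp (homEmb_embedding f'), rfl⟩
    obtain ⟨γ, hγ⟩ := Quotient.exact ho
    obtain ⟨k, hk, -⟩ := hGa.lift ((homEmb_embedding γ.toEmbedding).comp hh)
      ((homEmb_embedding u).comp (homEmb_embedding g'))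
      fun i => (hγ i).trans (congrArg u (hA.root_eq i))
    exact hUb ⟨G, hG, k, hk⟩
  refine Finite.of_injective (fun q : Quotient (pieceEquiv F n) => d q.out) fun q q' e => ?_
  rw [← Quotient.out_eq q, ← Quotient.out_eq q']
  exact Quotient.sound ((key _ _ e).antisymm (key _ _ e.symm))

end Categoricity

end ForbLift

theorem theorem3p3 (L : FirstOrder.Language.{u, v}) [L.IsRelational]
    [Finite (Σ n, L.Relations n)] (hL : IsEmpty (L.Relations 0))
    (F : Set (CategoryTheory.Bundled.{0} L.Structure))
    (hfin : ∀ G ∈ F, Finite G) (hconn : ∀ G ∈ F, ForbLift.IsConn L G)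
    (hup : ForbLift.UpwardsClosed F) :
    List.TFAE [
      ForbLift.IsRegular F,
      ∃ (L' : FirstOrder.Language.{0, 0}) (U : CategoryTheory.Bundled.{0} (L.sum L').Structure),
        L'.IsRelational ∧ IsEmpty (L'.Relations 0) ∧ (∀ n, Finite (L'.Relations n)) ∧
        (∀ (n : ℕ) (r : L'.Relations n) (t : Fin n → U),
          FirstOrder.Language.Structure.RelMap (L := L.sum L') (Sum.inr r) t →
            Function.Injective t) ∧
        (L.sum L').IsUltrahomogeneous U ∧
        ForbLift.shadow U ∈ ForbLift.Forb F ∧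
        ForbLift.IsUniversalFor (ForbLift.shadow U) (ForbLift.Forb F),
      ∃ U ∈ ForbLift.Forb F, ForbLift.IsUniversalFor U (ForbLift.Forb F) ∧
        ForbLift.IsOmegaCategorical L U] := by
  have hF : ForbLift.IsAdmissible F := ⟨hfin, hconn, hup⟩
  tfae_have 1 → 2 := fun h => h.exists_ultrahomogeneous_lift hL hF
  tfae_have 2 → 3 := by
    rintro ⟨L', U, hrel, -, hfin', hinj, hhom, hforb, huniv⟩
    exact ⟨ForbLift.shadow U, hforb, huniv, ForbLift.isOmegaCategorical_shadow hfin' hinj hhom⟩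
  tfae_have 3 → 1 := by
    rintro ⟨U, hU, huniv, hcat⟩
    exact ForbLift.isRegular_of_universal hF hU huniv hcat
  tfae_finish
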